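/- Let $\gamma,\lambda,\mu>0$. Let $H_\gamma$ be the operator in $L^2(\mathbb R)$ (complex-valued functions) with domain $$D(H_\gamma)=\{\psi\in H^2(\mathbb R\setminus\{0\}):\ \psi'(0^+)=\psi'(0^-),\ \psi(0^+)-\psi(0^-)=-\gamma\,\psi'(0^+)\}$$ and action $H_\gamma\psi=-\psi''$ on $\mathbb R\setminus\{0\}$ (the attractive $\delta'$ interaction). Let $Q=H^1(\mathbb R^+)\oplus H^1(\mathbb R^-)$, with norm $\|\psi\|_Q^2=\|\psi\|^2+\|\psi'\|^2$, where $\|\cdot\|$ is the $L^2$-norm and $\psi'$ is the weak derivative on $\mathbb R\setminus\{0\}$, and let $Q^\star$ be its dual, in which $Q$ is embedded through the $L^2$ scalar product. Then $H_\gamma$ generates a strongly continuous unitary group $(e^{-iH_\gamma t})_{t\in\mathbb R}$ on $L^2(\mathbb R)$, with generator exactly $-iH_\gamma$, and for every $\psi_0\in Q$ the following hold for the equation $$\psi(t)=e^{-iH_\gamma t}\psi_0+i\lambda\int_0^t e^{-iH_\gamma(t-s)}\,|\psi(s)|^{2\mu}\psi(s)\,ds .\qquad(*)$$ 1. There exists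 $T>0$ such that $(*)$ has a unique solution $\psi\in C^0([0,T),Q)\cap C^1([0,T),Q^\star)$ on $[0,T)$. 2. There are $T^\star\in(0,\infty]$ and a maximal solution $\psi^{\max}\in C^0([0,T^\star),Q)\cap C^1([0,T^\star),Q^\star)$ of $(*)$ on $[0,T^\star)$: every solution of $(*)$ in $C^0([0,T),Q)\cap C^1([0,T),Q^\star)$ on an interval $[0,T)$, $0<T\le\infty$, satisfies $T\le T^\star$ and coincides with $\psi^{\max}$ on $[0,T)$. Moreover, either $T^\star=\infty$ or $$\lim_{t\to T^\star}\|\psi^{\max}(t)\|_Q=+\infty .$$ -/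

import Mathlib

open MeasureTheory Filter Topology Set
open scoped ContDiff

noncomputable section

namespace DeltaPrimeNLS

/-- The Hilbert space `L²(ℝ)` of complex-valued functions. -/
abbrev L2R : Type := Lp ℂ 2 (volume : Measure ℝ)

/-- `g` is the weak derivative of `f` on `ℝ \ {0}`: `∫ φ' f = - ∫ φ g` for all test functions
`φ ∈ C_c^∞(ℝ \ {0})`. -/
def IsWeakDeriv (f g : L2R) : Prop :=
  ∀ φ : ℝ → ℝ, ContDiff ℝ ∞ φ → HasCompactSupport φ → tsupport φ ⊆ {(0 : ℝ)}ᶜ →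
    ∫ x, deriv φ x • f x = - ∫ x, φ x • g x

theorem integrable_smul_L2R {φ : ℝ → ℝ} (hφ : Continuous φ) (hc : HasCompactSupport φ)
    (f : L2R) : Integrable (fun x => φ x • f x) :=
  ((Lp.memLp f).locallyIntegrable (by norm_num)).integrable_smul_left_of_hasCompactSupport hφ hc

theorem IsWeakDeriv.zero : IsWeakDeriv 0 0 := by
  intro φ _ _ _
  have h : ∀ a : ℝ → ℝ, ∫ x, a x • (0 : L2R) x = 0 := fun a => by
    refine integral_eq_zero_of_ae ?_
    filter_upwards with x
    simp
  rw [h, h, neg_zero]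

theorem IsWeakDeriv.add {f g f' g' : L2R} (h : IsWeakDeriv f g) (h' : IsWeakDeriv f' g') :
    IsWeakDeriv (f + f') (g + g') := by
  intro φ h1 h2 h3
  have key : ∀ a : ℝ → ℝ, Continuous a → HasCompactSupport a → ∀ u v : L2R,
      ∫ x, a x • (u + v) x = (∫ x, a x • u x) + ∫ x, a x • v x := by
    intro a ha hc u v
    rw [← integral_add (integrable_smul_L2R ha hc u) (integrable_smul_L2R ha hc v)]
    refine integral_congr_ae ?_
    filter_upwards [Lp.coeFn_add u v] with x hx
    simp only [hx, Pi.add_apply, smul_add]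
  rw [key _ (h1.continuous_deriv (by simp)) h2.deriv, key _ h1.continuous h2,
    h φ h1 h2 h3, h' φ h1 h2 h3]
  ring

theorem IsWeakDeriv.smul {f g : L2R} (c : ℂ) (h : IsWeakDeriv f g) :
    IsWeakDeriv (c • f) (c • g) := by
  intro φ h1 h2 h3
  have key : ∀ a : ℝ → ℝ, ∀ u : L2R, ∫ x, a x • (c • u) x = c • ∫ x, a x • u x := by
    intro a u
    rw [← integral_smul]
    refine integral_congr_ae ?_
    filter_upwards [Lp.coeFn_smul c u] with x hx
    simp only [hx, Pi.smul_apply]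
    exact smul_comm _ _ _
  rw [key, key, h φ h1 h2 h3, smul_neg]

/-- The weak derivative is unique. -/
theorem IsWeakDeriv.eq_zero {g : L2R} (h : IsWeakDeriv 0 g) : g = 0 := by
  have h0 : ∀ a : ℝ → ℝ, ∫ x, a x • (0 : L2R) x = 0 := fun a => by
    refine integral_eq_zero_of_ae ?_
    filter_upwards with x
    simp
  have key := (isOpen_compl_singleton (x := (0 : ℝ))).ae_eq_zero_of_integral_contDiff_smul_eq_zero
    (μ := volume) (f := g) (((Lp.memLp g).locallyIntegrable (by norm_num)).locallyIntegrableOn _)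
    (fun φ h1 h2 h3 => by
      have := h φ h1 h2 h3
      rw [h0] at this
      exact neg_eq_zero.mp this.symm)
  refine (Lp.eq_zero_iff_ae_eq_zero).mpr ?_
  filter_upwards [key, Measure.ae_ne volume (0 : ℝ)] with x hx hx0
  exact hx hx0

/-- The energy space `Q = H¹(ℝ⁺) ⊕ H¹(ℝ⁻)`. An element is recorded as the pair `(ψ, ψ')` of a
function in `L²(ℝ)` and its weak derivative on `ℝ \ {0}`, also in `L²(ℝ)`; the second component
is determined by the first. The norm is `‖ψ‖_Q² = ‖ψ‖² + ‖ψ'‖²`. -/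
def EnergySpace : Submodule ℂ (WithLp 2 (L2R × L2R)) where
  carrier := {u | IsWeakDeriv u.fst u.snd}
  zero_mem' := IsWeakDeriv.zero
  add_mem' := fun hu hv => IsWeakDeriv.add hu hv
  smul_mem' := fun c _ hu => IsWeakDeriv.smul c hu

/-- The continuous inclusion `Q ⊆ L²(ℝ)`. -/
def toL2 : EnergySpace →L[ℂ] L2R :=
  (WithLp.fstL 2 ℂ L2R L2R).comp EnergySpace.subtypeL

theorem norm_sq_energySpace (u : EnergySpace) :
    ‖u‖ ^ 2 = ‖toL2 u‖ ^ 2 + ‖(u : WithLp 2 (L2R × L2R)).snd‖ ^ 2 :=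
  WithLp.prod_norm_sq_eq_of_L2 (u : WithLp 2 (L2R × L2R))

theorem toL2_injective : Function.Injective toL2 := by
  refine (injective_iff_map_eq_zero toL2).mpr fun u hu => ?_
  have h1 : (u : WithLp 2 (L2R × L2R)).fst = 0 := hu
  have h2 : IsWeakDeriv (u : WithLp 2 (L2R × L2R)).fst (u : WithLp 2 (L2R × L2R)).snd := u.2
  rw [h1] at h2
  have h3 := h2.eq_zero
  have h4 := norm_sq_energySpace u
  rw [hu, h3] at h4
  simpa using h4

/-- The embedding of `Q` into its dual `Q*`, through the scalar product of `L²(ℝ)` (antilinear in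
its first argument): `ψ` acts on `Q` as `φ ↦ (ψ, φ)`. -/
def toDual (u : EnergySpace) : StrongDual ℂ EnergySpace :=
  (innerSL ℂ (toL2 u)).comp toL2

/-- `f(0+) = a`, as an essential limit. -/
def HasRightTrace (f : L2R) (a : ℂ) : Prop :=
  Tendsto (f : ℝ → ℂ) (𝓝[>] (0 : ℝ) ⊓ ae volume) (𝓝 a)

/-- `f(0-) = a`, as an essential limit. -/
def HasLeftTrace (f : L2R) (a : ℂ) : Prop :=
  Tendsto (f : ℝ → ℂ) (𝓝[<] (0 : ℝ) ⊓ ae volume) (𝓝 a)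

theorem trace_zero (l : Filter ℝ) :
    Tendsto ((0 : L2R) : ℝ → ℂ) (l ⊓ ae volume) (𝓝 0) := by
  refine tendsto_const_nhds.congr' (EventuallyEq.symm ?_)
  exact (Lp.coeFn_zero ℂ 2 (volume : Measure ℝ)).filter_mono inf_le_right

theorem trace_add {l : Filter ℝ} {f g : L2R} {a b : ℂ}
    (hf : Tendsto (f : ℝ → ℂ) (l ⊓ ae volume) (𝓝 a))
    (hg : Tendsto (g : ℝ → ℂ) (l ⊓ ae volume) (𝓝 b)) :
    Tendsto ((f + g : L2R) : ℝ → ℂ) (l ⊓ ae volume) (𝓝 (a + b)) := by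
  refine (hf.add hg).congr' (EventuallyEq.symm ?_)
  exact (Lp.coeFn_add f g).filter_mono inf_le_right

theorem trace_smul {l : Filter ℝ} {f : L2R} {a : ℂ} (c : ℂ)
    (hf : Tendsto (f : ℝ → ℂ) (l ⊓ ae volume) (𝓝 a)) :
    Tendsto ((c • f : L2R) : ℝ → ℂ) (l ⊓ ae volume) (𝓝 (c • a)) := by
  refine (hf.const_smul c).congr' (EventuallyEq.symm ?_)
  exact (Lp.coeFn_smul c f).filter_mono inf_le_right

/-- The graph of the `δ'` Hamiltonian `H_γ`: the pairs `(ψ, -ψ'')` with `ψ ∈ H²(ℝ \ {0})`,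
`ψ'(0+) = ψ'(0-) = c` and `ψ(0+) - ψ(0-) = -γ c`. -/
def hamiltonianGraph (γ : ℝ) : Submodule ℂ (L2R × L2R) where
  carrier := {p | ∃ ψ' : L2R, IsWeakDeriv p.1 ψ' ∧ IsWeakDeriv ψ' (-p.2) ∧
    ∃ a b c : ℂ, HasRightTrace p.1 a ∧ HasLeftTrace p.1 b ∧
      HasRightTrace ψ' c ∧ HasLeftTrace ψ' c ∧ a - b = -(γ : ℂ) * c}
  zero_mem' := ⟨0, IsWeakDeriv.zero, by simpa using IsWeakDeriv.zero, 0, 0, 0,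
    trace_zero _, trace_zero _, trace_zero _, trace_zero _, by simp⟩
  add_mem' := by
    rintro p q ⟨p', h1, h2, a, b, c, h3, h4, h5, h6, h7⟩
      ⟨q', k1, k2, a', b', c', k3, k4, k5, k6, k7⟩
    refine ⟨p' + q', h1.add k1, ?_, a + a', b + b', c + c', trace_add h3 k3, trace_add h4 k4,
      trace_add h5 k5, trace_add h6 k6, ?_⟩
    · have := h2.add k2
      rwa [← neg_add] at this
    · linear_combination h7 + k7
  smul_mem' := by
    rintro z p ⟨p', h1, h2, a, b, c, h3, h4, h5, h6, h7⟩
    refine ⟨z • p', h1.smul z, ?_, z • a, z • b, z • c, trace_smul z h3, trace_smul z h4,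
      trace_smul z h5, trace_smul z h6, ?_⟩
    · have := h2.smul z
      rwa [smul_neg] at this
    · simp only [smul_eq_mul]
      linear_combination z * h7

/-- The `δ'` Hamiltonian `H_γ`, an unbounded operator in `L²(ℝ)`, as the partially defined linear
map with the graph above. -/
def hamiltonian (γ : ℝ) : L2R →ₗ.[ℂ] L2R := (hamiltonianGraph γ).toLinearPMap

theorem hamiltonian_graph (γ : ℝ) : (hamiltonian γ).graph = hamiltonianGraph γ := by
  refine Submodule.toLinearPMap_graph_eq _ ?_
  rintro ⟨x, y⟩ ⟨ψ', h1, h2, -⟩ hx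
  simp only at hx h1 h2 ⊢
  subst hx
  have h3 := h1.eq_zero
  subst h3
  simpa using h2.eq_zero

/-- `U` is the strongly continuous one-parameter unitary group `t ↦ e^{-iAt}` generated by `A`:
the orbit of `x` is differentiable at `0` with derivative `-i y` exactly when `x` lies in the
domain of `A` and `A x = y`. Such a group is unique if it exists. -/
structure IsUnitaryGroupOf {E : Type*} [NormedAddCommGroup E] [InnerProductSpace ℂ E]
    [CompleteSpace E] (A : E →ₗ.[ℂ] E) (U : ℝ → E →L[ℂ] E) : Prop where
  mem_unitary : ∀ t, U t ∈ unitary (E →L[ℂ] E)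
  map_zero : U 0 = 1
  map_add : ∀ s t, U (s + t) = U s * U t
  continuous : ∀ x, Continuous fun t => U t x
  generator : ∀ x y, (x, y) ∈ A.graph ↔
    HasDerivAt (fun t : ℝ => U t x) (-(Complex.I • y)) 0

/-- The propagator `t ↦ e^{-i H_γ t}`: the unitary group generated by `H_γ`. -/
def propagator (γ : ℝ) : ℝ → L2R →L[ℂ] L2R :=
  Classical.epsilon fun U => IsUnitaryGroupOf (hamiltonian γ) U

/-- The pointwise nonlinearity `|f|^{2μ} f`. -/
def powFun (μ : ℝ) (f : ℝ → ℂ) (x : ℝ) : ℂ := ((‖f x‖ ^ (2 * μ) : ℝ) : ℂ) * f x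

open Classical in
/-- `|f|^{2μ} f` as an element of `L²(ℝ)`; only used where it is square integrable. -/
def nonlinearity (μ : ℝ) (f : L2R) : L2R :=
  if h : MemLp (powFun μ f) 2 (volume : Measure ℝ) then h.toLp else 0

/-- The interval `[0, T)`, where `T = ∞` is allowed. -/
def timeInterval (T : EReal) : Set ℝ := {t | 0 ≤ t ∧ (t : EReal) < T}

/-- `ψ` belongs to `C⁰([0,T), Q) ∩ C¹([0,T), Q*)` and solves
`ψ(t) = e^{-i H_γ t} ψ₀ + i λ ∫₀ᵗ e^{-i H_γ (t-s)} |ψ(s)|^{2μ} ψ(s) ds` on `[0,T)`. The values of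
`ψ` outside of `[0,T)` are irrelevant. -/
structure IsSolution (γ lam μ : ℝ) (ψ₀ : EnergySpace) (T : EReal) (ψ : ℝ → EnergySpace) :
    Prop where
  continuousOn : ContinuousOn ψ (timeInterval T)
  contDiffOn : ContDiffOn ℝ 1 (fun t => toDual (ψ t)) (timeInterval T)
  memLp : ∀ t ∈ timeInterval T, MemLp (powFun μ (toL2 (ψ t))) 2 (volume : Measure ℝ)
  integrable : ∀ t ∈ timeInterval T, IntervalIntegrable
    (fun s => propagator γ (t - s) (nonlinearity μ (toL2 (ψ s)))) volume 0 t
  duhamel : ∀ t ∈ timeInterval T, toL2 (ψ t) = propagator γ t (toL2 ψ₀) +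
    (Complex.I * (lam : ℂ)) •
      ∫ s in (0 : ℝ)..t, propagator γ (t - s) (nonlinearity μ (toL2 (ψ s)))

end DeltaPrimeNLS

end

/-!
For large `m` the form `‖ψ'‖² - |ψ(0+) - ψ(0-)|² / γ + m ‖ψ‖²` is coercive on `Q`. By Lax-Milgram,
`H_γ + m` therefore has a bounded self-adjoint inverse `K` with dense range, and
`e^{-i H_γ t} = e^{-i t (1/K - m)}` is given by the functional calculus of `K`. The group conserves
the form, so it is uniformly bounded on `Q`. Since `Q` embeds in `L^∞`, the nonlinearity maps balls
of `Q` to balls of `Q` and is Lipschitz there for the norm of `L²`. A ball of `Q` is complete for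
that norm, so the contraction principle gives a solution on a time interval whose length depends
only on the norm of the initial value in `Q`; this implies the blow-up alternative.
-/

noncomputable section

namespace DeltaPrimeNLS

/-! ### Locally absolutely continuous functions -/

section LocallyIntegrable

variable {E : Type*} [NormedAddCommGroup E]

theorem intervalIntegrable_of_locallyIntegrable {g : ℝ → E} (hg : LocallyIntegrable g) (a b : ℝ) :
    IntervalIntegrable g volume a b :=
  intervalIntegrable_iff.2 <|
    (hg.integrableOn_isCompact isCompact_uIcc).mono_set uIoc_subset_uIcc

theorem locallyIntegrable_norm {g : ℝ → E} (hg : LocallyIntegrable g) :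
    LocallyIntegrable fun x => ‖g x‖ :=
  locallyIntegrableOn_univ.1 (locallyIntegrableOn_univ.2 hg).norm

theorem locallyIntegrable_clm_comp {F : Type*} [NormedAddCommGroup F] [NormedSpace ℝ E]
    [NormedSpace ℝ F] (A : E →L[ℝ] F) {g : ℝ → E} (hg : LocallyIntegrable g) :
    LocallyIntegrable fun x => A (g x) := fun x => by
  obtain ⟨s, hs, hi⟩ := hg x
  exact ⟨s, hs, A.integrable_comp hi⟩

end LocallyIntegrable

section AbsolutelyContinuous

theorem absolutelyContinuousOnInterval_of_dist_le {X Y : Type*} [PseudoMetricSpace X]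
    [PseudoMetricSpace Y] {p : ℝ → X} {q : ℝ → Y} {a b C : ℝ}
    (hpq : ∀ x ∈ uIcc a b, ∀ y ∈ uIcc a b, dist (p x) (p y) ≤ C * dist (q x) (q y))
    (hq : AbsolutelyContinuousOnInterval q a b) : AbsolutelyContinuousOnInterval p a b := by
  unfold AbsolutelyContinuousOnInterval at hq ⊢
  refine squeeze_zero' (Eventually.of_forall fun I => Finset.sum_nonneg fun i _ => dist_nonneg)
    ?_ (by simpa only [mul_zero] using hq.const_mul C)
  filter_upwards [mem_inf_of_right (mem_principal_self _)] with I hI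
  rw [Finset.mul_sum]
  exact Finset.sum_le_sum fun i hi => hpq _ (hI.1 i hi).1 _ (hI.1 i hi).2

theorem ae_differentiableAt_of_absolutelyContinuousOnInterval {E : Type*} [NormedAddCommGroup E]
    [NormedSpace ℝ E] [FiniteDimensional ℝ E] {p : ℝ → E}
    (hp : ∀ a b, AbsolutelyContinuousOnInterval p a b) : ∀ᵐ x, DifferentiableAt ℝ p x := by
  have hball : ∀ᵐ x, ∀ n : ℕ, x ∈ uIcc (-(n : ℝ)) n → DifferentiableAt ℝ p x :=
    ae_all_iff.2 fun n => (hp (-n) n).boundedVariationOn.ae_differentiableAt_of_mem_uIcc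
  filter_upwards [hball] with x hx
  obtain ⟨n, hxn⟩ := exists_nat_ge |x|
  refine hx n ?_
  rw [uIcc_of_le (neg_le_self n.cast_nonneg)]
  exact abs_le.1 hxn

end AbsolutelyContinuous

/-- `p` is a locally absolutely continuous function with a.e. derivative `g`. -/
structure IsPrimitive {E : Type*} [NormedAddCommGroup E] [NormedSpace ℝ E] (p g : ℝ → E) :
    Prop where
  locallyIntegrable : LocallyIntegrable g
  sub_eq : ∀ x y, p y - p x = ∫ t in x..y, g t

namespace IsPrimitive

variable {E F : Type*} [NormedAddCommGroup E] [NormedSpace ℝ E] [NormedAddCommGroup F]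
  {p g : ℝ → E}

theorem const_add_integral {g : ℝ → E} (hg : LocallyIntegrable g) (c : E) :
    IsPrimitive (fun x => c + ∫ t in (0 : ℝ)..x, g t) g :=
  ⟨hg, fun _ _ => by
    rw [add_sub_add_left_eq_sub]
    exact intervalIntegral.integral_interval_sub_left
      (intervalIntegrable_of_locallyIntegrable hg _ _)
      (intervalIntegrable_of_locallyIntegrable hg _ _)⟩

theorem of_contDiff [CompleteSpace E] (hp : ContDiff ℝ 1 p) : IsPrimitive p (deriv p) :=
  ⟨(hp.continuous_deriv le_rfl).locallyIntegrable, fun _ _ =>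
    (intervalIntegral.integral_deriv_eq_sub (fun _ _ => hp.differentiable one_ne_zero _)
      ((hp.continuous_deriv le_rfl).intervalIntegrable _ _)).symm⟩

theorem zero : IsPrimitive (0 : ℝ → E) 0 :=
  ⟨locallyIntegrable_zero, fun x y => by simp⟩

theorem intervalIntegrable (hp : IsPrimitive p g) (a b : ℝ) : IntervalIntegrable g volume a b :=
  intervalIntegrable_of_locallyIntegrable hp.locallyIntegrable a b

theorem eq_add_integral (hp : IsPrimitive p g) (a x : ℝ) : p x = p a + ∫ t in a..x, g t := by
  rw [← hp.sub_eq, add_sub_cancel]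

theorem continuous (hp : IsPrimitive p g) : Continuous p := by
  rw [funext (hp.eq_add_integral 0)]
  exact continuous_const.add (intervalIntegral.continuous_primitive hp.intervalIntegrable 0)

theorem ae_hasDerivAt [CompleteSpace E] (hp : IsPrimitive p g) : ∀ᵐ x, HasDerivAt p (g x) x := by
  filter_upwards [LocallyIntegrable.ae_hasDerivAt_integral hp.locallyIntegrable] with x hx
  rw [funext (hp.eq_add_integral 0)]
  exact (hx 0).const_add _

theorem absolutelyContinuousOnInterval (hp : IsPrimitive p g) (a b : ℝ) :
    AbsolutelyContinuousOnInterval p a b := by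
  have hg := intervalIntegrable_of_locallyIntegrable (locallyIntegrable_norm hp.locallyIntegrable)
  refine absolutelyContinuousOnInterval_of_dist_le (C := 1) (fun x _ y _ => ?_)
    ((hg a b).absolutelyContinuousOnInterval_intervalIntegral (c := a) left_mem_uIcc)
  rw [one_mul, dist_eq_norm, dist_eq_norm, hp.sub_eq, Real.norm_eq_abs,
    intervalIntegral.integral_interval_sub_left (hg _ _) (hg _ _)]
  exact intervalIntegral.norm_integral_le_abs_integral_norm

theorem of_absolutelyContinuousOnInterval [CompleteSpace E] (hg : LocallyIntegrable g)
    (hp : ∀ a b, AbsolutelyContinuousOnInterval p a b) (hderiv : ∀ᵐ x, HasDerivAt p (g x) x) :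
    IsPrimitive p g := by
  refine ⟨hg, fun x y => ?_⟩
  have hG := const_add_integral hg 0
  obtain ⟨C, hC⟩ := ((hp x y).sub
    (hG.absolutelyContinuousOnInterval x y)).const_of_ae_hasDerivAt_zero (by
      filter_upwards [hderiv, hG.ae_hasDerivAt] with s hps hGs _
      simpa only [sub_self] using hps.sub hGs)
  rw [← hG.sub_eq, sub_eq_sub_iff_sub_eq_sub]
  exact (hC y right_mem_uIcc).trans (hC x left_mem_uIcc).symm

theorem clm_comp [CompleteSpace E] [NormedSpace ℝ F] [CompleteSpace F] (A : E →L[ℝ] F)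
    (hp : IsPrimitive p g) : IsPrimitive (fun x => A (p x)) fun x => A (g x) :=
  ⟨locallyIntegrable_clm_comp A hp.locallyIntegrable, fun x y => by
    rw [← map_sub, hp.sub_eq, A.intervalIntegral_comp_comm (hp.intervalIntegrable x y)]⟩

theorem smul {𝕜 : Type*} [NormedField 𝕜] [NormedAlgebra ℝ 𝕜] [CompleteSpace 𝕜]
    [NormedSpace 𝕜 E] [IsScalarTower ℝ 𝕜 E] [CompleteSpace E] {c c' : ℝ → 𝕜}
    (hc : IsPrimitive c c') (hp : IsPrimitive p g) :
    IsPrimitive (fun x => c x • p x) fun x => c x • g x + c' x • p x := by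
  refine of_absolutelyContinuousOnInterval
    ((hp.locallyIntegrable.continuous_smul hc.continuous).add
      (hc.locallyIntegrable.smul_continuous hp.continuous))
    (fun a b => (hc.absolutelyContinuousOnInterval a b).smul
      (hp.absolutelyContinuousOnInterval a b)) ?_
  filter_upwards [hc.ae_hasDerivAt, hp.ae_hasDerivAt] with x hcx hpx
  exact hcx.smul hpx

theorem integral_Ioi [CompleteSpace E] (hp : IsPrimitive p g) {a : ℝ}
    (hpi : IntegrableOn p (Ioi a)) (hgi : IntegrableOn g (Ioi a)) :
    ∫ x in Ioi a, g x = -p a := by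
  have hlim : Tendsto p atTop (𝓝 (p a + ∫ x in Ioi a, g x)) := by
    refine ((intervalIntegral_tendsto_integral_Ioi a hgi tendsto_id).const_add (p a)).congr
      fun x => ?_
    rw [id, ← hp.sub_eq, add_sub_cancel]
  have hzero := IntegrableAtFilter.eq_zero_of_tendsto ⟨Ioi a, Ioi_mem_atTop _, hpi⟩
    (fun s hs => by
      obtain ⟨b, hb⟩ := mem_atTop_sets.1 hs
      exact measure_mono_top hb Real.volume_Ici) hlim
  exact eq_neg_of_add_eq_zero_right hzero

theorem integral_Iio [CompleteSpace E] (hp : IsPrimitive p g) {a : ℝ}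
    (hpi : IntegrableOn p (Iio a)) (hgi : IntegrableOn g (Iio a)) :
    ∫ x in Iio a, g x = p a := by
  rw [← integrableOn_Iic_iff_integrableOn_Iio] at hpi hgi
  rw [← integral_Iic_eq_integral_Iio]
  have hlim : Tendsto p atBot (𝓝 (p a - ∫ x in Iic a, g x)) := by
    refine ((intervalIntegral_tendsto_integral_Iic a hgi tendsto_id).const_sub (p a)).congr
      fun x => ?_
    rw [id, ← hp.sub_eq, sub_sub_cancel]
  have hzero := IntegrableAtFilter.eq_zero_of_tendsto ⟨Iic a, Iic_mem_atBot _, hpi⟩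
    (fun s hs => by
      obtain ⟨b, hb⟩ := mem_atBot_sets.1 hs
      exact measure_mono_top hb Real.volume_Iic) hlim
  exact (sub_eq_zero.1 hzero).symm

section Composition

variable {Φ : E → F} {M : ℝ → ℝ}

theorem absolutelyContinuousOnInterval_comp (hp : IsPrimitive p g)
    (hΦ : ∀ r z w, ‖z‖ ≤ r → ‖w‖ ≤ r → ‖Φ z - Φ w‖ ≤ M r * ‖z - w‖) (a b : ℝ) :
    AbsolutelyContinuousOnInterval (fun x => Φ (p x)) a b := by
  obtain ⟨R, hR⟩ := isCompact_uIcc.exists_bound_of_continuousOn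
    (hp.continuous.continuousOn (s := uIcc a b))
  refine absolutelyContinuousOnInterval_of_dist_le (C := M R) (fun x hx y hy => ?_)
    (hp.absolutelyContinuousOnInterval a b)
  rw [dist_eq_norm, dist_eq_norm]
  exact hΦ R _ _ (hR x hx) (hR y hy)

theorem norm_deriv_comp_le [NormedSpace ℝ F] (hM : Continuous M)
    (hΦ : ∀ r z w, ‖z‖ ≤ r → ‖w‖ ≤ r → ‖Φ z - Φ w‖ ≤ M r * ‖z - w‖) {x : ℝ} {p' : E} {d : F}
    (hp : HasDerivAt p p' x) (hderiv : HasDerivAt (fun x => Φ (p x)) d x) :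
    ‖d‖ ≤ M ‖p x‖ * ‖p'‖ := by
  have hmax : Tendsto (fun y => max ‖p y‖ ‖p x‖) (𝓝[≠] x) (𝓝 ‖p x‖) := by
    have h : Tendsto (fun y => max ‖p y‖ ‖p x‖) (𝓝 x) (𝓝 (max ‖p x‖ ‖p x‖)) :=
      hp.continuousAt.norm.max continuousAt_const
    rw [max_self] at h
    exact h.mono_left nhdsWithin_le_nhds
  refine le_of_tendsto_of_tendsto (hasDerivAt_iff_tendsto_slope.1 hderiv).norm
    (((hM.tendsto _).comp hmax).mul (hasDerivAt_iff_tendsto_slope.1 hp).norm)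
    (Eventually.of_forall fun y => ?_)
  simp only [slope_def_module, norm_smul, Function.comp_apply]
  rw [mul_left_comm]
  exact mul_le_mul_of_nonneg_left (hΦ _ _ _ (le_max_left _ _) (le_max_right _ _)) (norm_nonneg _)

theorem comp_locallyLipschitz [CompleteSpace E] [NormedSpace ℝ F] [FiniteDimensional ℝ F]
    (hp : IsPrimitive p g) (hM : Continuous M)
    (hΦ : ∀ r z w, ‖z‖ ≤ r → ‖w‖ ≤ r → ‖Φ z - Φ w‖ ≤ M r * ‖z - w‖) :
    ∃ k, IsPrimitive (fun x => Φ (p x)) k ∧ ∀ᵐ x, ‖k x‖ ≤ M ‖p x‖ * ‖g x‖ := by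
  have := FiniteDimensional.complete ℝ F
  have hac := hp.absolutelyContinuousOnInterval_comp hΦ
  have hderiv : ∀ᵐ x, HasDerivAt (fun x => Φ (p x)) (deriv (fun x => Φ (p x)) x) x :=
    (ae_differentiableAt_of_absolutelyContinuousOnInterval hac).mono fun x hx => hx.hasDerivAt
  have hbound : ∀ᵐ x, ‖deriv (fun x => Φ (p x)) x‖ ≤ M ‖p x‖ * ‖g x‖ := by
    filter_upwards [hp.ae_hasDerivAt, hderiv] with x hpx hdx
    exact norm_deriv_comp_le hM hΦ hpx hdx
  have hloc : LocallyIntegrable fun x => M ‖p x‖ * ‖g x‖ :=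
    (locallyIntegrable_norm hp.locallyIntegrable).continuous_smul
      (hM.comp hp.continuous.norm)
  refine ⟨_, of_absolutelyContinuousOnInterval (hloc.mono ?_ ?_) hac hderiv, hbound⟩
  · exact aestronglyMeasurable_deriv _ _
  · filter_upwards [hbound] with x hx
    exact hx.trans (le_abs_self _)

end Composition

end IsPrimitive

/-! ### Weak derivatives on the punctured line -/

section DuBoisReymond

theorem exists_deriv_eq_of_integral_eq_zero {U : Set ℝ} (hU : U.OrdConnected) {η : ℝ → ℝ}
    (hη : ContDiff ℝ ∞ η) (hηc : HasCompactSupport η) (hηU : tsupport η ⊆ U)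
    (hη0 : ∫ x, η x = 0) :
    ∃ φ : ℝ → ℝ, ContDiff ℝ ∞ φ ∧ HasCompactSupport φ ∧ tsupport φ ⊆ U ∧ deriv φ = η := by
  rcases (tsupport η).eq_empty_or_nonempty with hempty | hne
  · obtain rfl : η = 0 := tsupport_eq_empty_iff.1 hempty
    exact ⟨0, contDiff_const, HasCompactSupport.zero, by simp, by simp⟩
  have hηi : Integrable η := hη.continuous.integrable_of_hasCompactSupport hηc
  set a := sInf (tsupport η)
  set b := sSup (tsupport η)
  have hab : tsupport η ⊆ Icc a b := fun x hx =>
    ⟨csInf_le hηc.isCompact.bddBelow hx, le_csSup hηc.isCompact.bddAbove hx⟩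
  have hout : ∀ x ∉ Icc a b, η x = 0 := fun x hx =>
    image_eq_zero_of_notMem_tsupport fun h => hx (hab h)
  have hderiv : ∀ x, HasDerivAt (fun x => ∫ t in Iic x, η t) (η x) x := fun x => by
    have h := (intervalIntegral.integral_hasDerivAt_right (hη.continuous.intervalIntegrable 0 x)
      (hη.continuous.stronglyMeasurableAtFilter _ _) hη.continuous.continuousAt).const_add
      (∫ t in Iic (0 : ℝ), η t)
    refine h.congr_of_eventuallyEq (Eventually.of_forall fun y => ?_)
    exact eq_add_of_sub_eq'
      (intervalIntegral.integral_Iic_sub_Iic hηi.integrableOn hηi.integrableOn)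
  have hsupp : Function.support (fun x => ∫ t in Iic x, η t) ⊆ Icc a b := by
    refine Function.support_subset_iff'.2 fun x hx => ?_
    rcases not_and_or.1 hx with hxa | hxb
    · exact setIntegral_eq_zero_of_forall_eq_zero fun t ht =>
        hout t fun h => hxa (h.1.trans ht)
    · rw [setIntegral_eq_integral_of_forall_compl_eq_zero, hη0]
      exact fun t ht => hout t fun h => ht (h.2.trans (not_le.1 hxb).le)
  refine ⟨_, contDiff_infty_iff_deriv.2 ⟨fun x => (hderiv x).differentiableAt, ?_⟩,
    HasCompactSupport.of_support_subset_isCompact isCompact_Icc hsupp,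
    (closure_minimal hsupp isClosed_Icc).trans
      (hU.out (hηU (hηc.isCompact.sInf_mem hne)) (hηU (hηc.isCompact.sSup_mem hne))),
    funext fun x => (hderiv x).deriv⟩
  rwa [funext fun x => (hderiv x).deriv]

theorem exists_contDiff_integral_eq_one {U : Set ℝ} (hU : IsOpen U) (hne : U.Nonempty) :
    ∃ ρ : ℝ → ℝ, ContDiff ℝ ∞ ρ ∧ HasCompactSupport ρ ∧ tsupport ρ ⊆ U ∧ ∫ x, ρ x = 1 := by
  obtain ⟨x, hx⟩ := hne
  obtain ⟨ε, hε, hball⟩ := Metric.isOpen_iff.1 hU x hx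
  let β : ContDiffBump x := ⟨ε / 4, ε / 2, by positivity, by linarith⟩
  refine ⟨β.normed volume, β.contDiff_normed, β.hasCompactSupport_normed, ?_, β.integral_normed⟩
  rw [β.tsupport_normed_eq]
  exact (Metric.closedBall_subset_ball (half_lt_self hε)).trans hball

variable {E : Type*} [NormedAddCommGroup E] [NormedSpace ℝ E] [CompleteSpace E]

/- Any test function `ψ` differs from `(∫ ψ) • ρ` by the derivative of a test function. -/
theorem ae_eq_const_of_integral_deriv_smul_eq_zero {U : Set ℝ} (hU : IsOpen U)
    (hc : U.OrdConnected) (hne : U.Nonempty) {f : ℝ → E} (hf : LocallyIntegrable f)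
    (h : ∀ φ : ℝ → ℝ, ContDiff ℝ ∞ φ → HasCompactSupport φ → tsupport φ ⊆ U →
      ∫ x, deriv φ x • f x = 0) :
    ∃ c, ∀ᵐ x, x ∈ U → f x = c := by
  obtain ⟨ρ, hρ, hρc, hρU, hρ1⟩ := exists_contDiff_integral_eq_one hU hne
  refine ⟨∫ x, ρ x • f x, ?_⟩
  have hzero := hU.ae_eq_zero_of_integral_contDiff_smul_eq_zero (μ := volume)
    (f := fun x => f x - ∫ x, ρ x • f x)
    ((hf.sub (locallyIntegrable_const _)).locallyIntegrableOn _) fun ψ hψ hψc hψU => ?_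
  · filter_upwards [hzero] with x hx hxU
    exact sub_eq_zero.1 (hx hxU)
  have hψi := hψ.continuous.integrable_of_hasCompactSupport (μ := volume) hψc
  have hρi := hρ.continuous.integrable_of_hasCompactSupport (μ := volume) hρc
  have hψf := hf.integrable_smul_left_of_hasCompactSupport hψ.continuous hψc
  have hρf := hf.integrable_smul_left_of_hasCompactSupport hρ.continuous hρc
  have hcρf : Integrable fun x => (∫ y, ψ y) • ρ x • f x := hρf.smul _
  have hcρ : HasCompactSupport fun x => (∫ y, ψ y) * ρ x := hρc.mul_left
  obtain ⟨φ, hφ, hφc, hφU, hφ'⟩ := exists_deriv_eq_of_integral_eq_zero hc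
    (hψ.sub (contDiff_const.mul hρ)) (hψc.sub hcρ)
    ((tsupport_sub _ _).trans (union_subset hψU ((tsupport_mul_subset_right).trans hρU)))
    (by rw [integral_sub hψi (hρi.const_mul _), integral_const_mul, hρ1, mul_one, sub_self])
  have hφf := h φ hφ hφc hφU
  simp only [hφ', sub_smul, mul_smul] at hφf
  rw [integral_sub hψf hcρf, integral_smul, sub_eq_zero] at hφf
  simp only [smul_sub]
  rw [integral_sub hψf (hψi.smul_const _), integral_smul_const, hφf, sub_self]

end DuBoisReymond

/-- `f` is locally absolutely continuous on each of the half-lines `x > 0` and `x < 0`, with a.e.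
derivative `g` and boundary values `f(0+) = a`, `f(0-) = b`. Both functions matter only up to
null sets. -/
structure HasPiecewiseDeriv {E : Type*} [NormedAddCommGroup E] [NormedSpace ℝ E] (f g : ℝ → E)
    (a b : E) : Prop where
  locallyIntegrable : LocallyIntegrable g
  eq_right : ∀ᵐ x, 0 < x → f x = a + ∫ t in (0 : ℝ)..x, g t
  eq_left : ∀ᵐ x, x < 0 → f x = b + ∫ t in (0 : ℝ)..x, g t

theorem ae_of_ae_Ioi_of_ae_Iio {P : ℝ → Prop} (hR : ∀ᵐ x : ℝ, 0 < x → P x)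
    (hL : ∀ᵐ x : ℝ, x < 0 → P x) : ∀ᵐ x : ℝ, P x := by
  filter_upwards [hR, hL, Measure.ae_ne volume (0 : ℝ)] with x hxR hxL hx
  exact hx.lt_or_gt.elim hxL hxR

namespace HasPiecewiseDeriv

variable {E F : Type*} [NormedAddCommGroup E] [NormedSpace ℝ E] [NormedAddCommGroup F]
  [NormedSpace ℝ F] {f g f' g' : ℝ → E} {a b : E}

theorem isPrimitive_right (h : HasPiecewiseDeriv f g a b) :
    IsPrimitive (fun x => a + ∫ t in (0 : ℝ)..x, g t) g :=
  IsPrimitive.const_add_integral h.locallyIntegrable a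

theorem isPrimitive_left (h : HasPiecewiseDeriv f g a b) :
    IsPrimitive (fun x => b + ∫ t in (0 : ℝ)..x, g t) g :=
  IsPrimitive.const_add_integral h.locallyIntegrable b

theorem congr (h : HasPiecewiseDeriv f g a b) (hf : f =ᵐ[volume] f') (hg : g =ᵐ[volume] g') :
    HasPiecewiseDeriv f' g' a b where
  locallyIntegrable := h.locallyIntegrable.congr hg
  eq_right := by
    filter_upwards [h.eq_right, hf] with x hx hfx hx0
    rw [← hfx, hx hx0, intervalIntegral.integral_congr_ae_restrict (ae_restrict_of_ae hg)]
  eq_left := by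
    filter_upwards [h.eq_left, hf] with x hx hfx hx0
    rw [← hfx, hx hx0, intervalIntegral.integral_congr_ae_restrict (ae_restrict_of_ae hg)]

theorem piecewise {pR gR pL gL : ℝ → E} (hR : IsPrimitive pR gR) (hL : IsPrimitive pL gL)
    (hfR : ∀ᵐ x, 0 < x → f x = pR x) (hfL : ∀ᵐ x, x < 0 → f x = pL x)
    (hgR : ∀ᵐ x, 0 < x → g x = gR x) (hgL : ∀ᵐ x, x < 0 → g x = gL x) :
    HasPiecewiseDeriv f g (pR 0) (pL 0) where
  locallyIntegrable := by
    refine ((hR.locallyIntegrable.indicator (measurableSet_Ioi (a := (0 : ℝ)))).add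
      (hL.locallyIntegrable.indicator (measurableSet_Iio (a := (0 : ℝ))))).congr ?_
    refine ae_of_ae_Ioi_of_ae_Iio (hgR.mono fun x hx hx0 => ?_) (hgL.mono fun x hx hx0 => ?_)
    · simp [hx hx0, hx0, hx0.le]
    · simp [hx hx0, hx0, hx0.le]
  eq_right := hfR.mono fun x hx hx0 => by
    rw [hx hx0, hR.eq_add_integral 0]
    congr 1
    refine intervalIntegral.integral_congr_ae (hgR.mono fun t ht ht0 => (ht ?_).symm)
    rw [uIoc_of_le hx0.le] at ht0
    exact ht0.1
  eq_left := hfL.mono fun x hx hx0 => by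
    rw [hx hx0, hL.eq_add_integral 0]
    congr 1
    refine intervalIntegral.integral_congr_ae ?_
    filter_upwards [hgL, Measure.ae_ne volume (0 : ℝ)] with t ht ht0 htx
    rw [uIoc_of_ge hx0.le] at htx
    exact (ht (htx.2.lt_of_ne ht0)).symm

theorem clm_comp [CompleteSpace E] [CompleteSpace F] (A : E →L[ℝ] F)
    (h : HasPiecewiseDeriv f g a b) :
    HasPiecewiseDeriv (fun x => A (f x)) (fun x => A (g x)) (A a) (A b) := by
  simpa using piecewise (h.isPrimitive_right.clm_comp A) (h.isPrimitive_left.clm_comp A)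
    (h.eq_right.mono fun x hx hx0 => congrArg A (hx hx0))
    (h.eq_left.mono fun x hx hx0 => congrArg A (hx hx0)) (by simp) (by simp)

theorem comp_locallyLipschitz [CompleteSpace E] [FiniteDimensional ℝ F] {Φ : E → F} {M : ℝ → ℝ}
    (h : HasPiecewiseDeriv f g a b) (hM : Continuous M)
    (hΦ : ∀ r z w, ‖z‖ ≤ r → ‖w‖ ≤ r → ‖Φ z - Φ w‖ ≤ M r * ‖z - w‖) :
    ∃ k, HasPiecewiseDeriv (fun x => Φ (f x)) k (Φ a) (Φ b) ∧
      ∀ᵐ x, ‖k x‖ ≤ M ‖f x‖ * ‖g x‖ := by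
  obtain ⟨kR, hkR, hkR_le⟩ := h.isPrimitive_right.comp_locallyLipschitz hM hΦ
  obtain ⟨kL, hkL, hkL_le⟩ := h.isPrimitive_left.comp_locallyLipschitz hM hΦ
  have hright : ∀ x ∈ Ioi (0 : ℝ), (Ioi 0).piecewise kR kL x = kR x := fun x hx =>
    piecewise_eq_of_mem _ _ _ hx
  have hleft : ∀ x ∈ Iio (0 : ℝ), (Ioi 0).piecewise kR kL x = kL x := fun x hx =>
    piecewise_eq_of_notMem _ _ _ (notMem_Ioi.2 (mem_Iio.1 hx).le)
  refine ⟨(Ioi 0).piecewise kR kL, ?_, ae_of_ae_Ioi_of_ae_Iio ?_ ?_⟩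
  · simpa only [intervalIntegral.integral_same, add_zero] using
      piecewise hkR hkL (h.eq_right.mono fun x hx hx0 => congrArg Φ (hx hx0))
        (h.eq_left.mono fun x hx hx0 => congrArg Φ (hx hx0)) (.of_forall hright) (.of_forall hleft)
  · filter_upwards [h.eq_right, hkR_le] with x hx hk hx0
    rwa [hright x hx0, hx hx0]
  · filter_upwards [h.eq_left, hkL_le] with x hx hk hx0
    rwa [hleft x hx0, hx hx0]

theorem smul {𝕜 : Type*} [NormedField 𝕜] [NormedAlgebra ℝ 𝕜] [CompleteSpace 𝕜]
    [NormedSpace 𝕜 E] [IsScalarTower ℝ 𝕜 E] [CompleteSpace E] {c c' : ℝ → 𝕜} {α β : 𝕜}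
    (hc : HasPiecewiseDeriv c c' α β) (h : HasPiecewiseDeriv f g a b) :
    HasPiecewiseDeriv (fun x => c x • f x) (fun x => c x • g x + c' x • f x)
      (α • a) (β • b) := by
  have := piecewise (f := fun x => c x • f x) (g := fun x => c x • g x + c' x • f x)
    (hc.isPrimitive_right.smul h.isPrimitive_right) (hc.isPrimitive_left.smul h.isPrimitive_left)
    (by filter_upwards [hc.eq_right, h.eq_right] with x hcx hx hx0
        rw [hcx hx0, hx hx0])
    (by filter_upwards [hc.eq_left, h.eq_left] with x hcx hx hx0
        rw [hcx hx0, hx hx0])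
    (by filter_upwards [hc.eq_right, h.eq_right] with x hcx hx hx0
        rw [hcx hx0, hx hx0])
    (by filter_upwards [hc.eq_left, h.eq_left] with x hcx hx hx0
        rw [hcx hx0, hx hx0])
  simpa using this

theorem tendsto_right (h : HasPiecewiseDeriv f g a b) :
    Tendsto f (𝓝[>] (0 : ℝ) ⊓ ae volume) (𝓝 a) := by
  have hlim := (h.isPrimitive_right.continuous.tendsto 0).mono_left
    (inf_le_left.trans nhdsWithin_le_nhds : 𝓝[>] (0 : ℝ) ⊓ ae volume ≤ 𝓝 0)
  rw [intervalIntegral.integral_same, add_zero] at hlim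
  refine hlim.congr' ?_
  filter_upwards [mem_inf_of_left self_mem_nhdsWithin, mem_inf_of_right h.eq_right] with x hx0 hx
  exact (hx hx0).symm

theorem tendsto_left (h : HasPiecewiseDeriv f g a b) :
    Tendsto f (𝓝[<] (0 : ℝ) ⊓ ae volume) (𝓝 b) := by
  have hlim := (h.isPrimitive_left.continuous.tendsto 0).mono_left
    (inf_le_left.trans nhdsWithin_le_nhds : 𝓝[<] (0 : ℝ) ⊓ ae volume ≤ 𝓝 0)
  rw [intervalIntegral.integral_same, add_zero] at hlim
  refine hlim.congr' ?_
  filter_upwards [mem_inf_of_left self_mem_nhdsWithin, mem_inf_of_right h.eq_left] with x hx0 hx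
  exact (hx hx0).symm

section Integrable

variable [CompleteSpace E]

theorem integral_Ioi_right (h : HasPiecewiseDeriv f g a b) (hf : Integrable f)
    (hg : Integrable g) {x : ℝ} (hx : 0 ≤ x) :
    ∫ t in Ioi x, g t = -(a + ∫ t in (0 : ℝ)..x, g t) := by
  refine h.isPrimitive_right.integral_Ioi (hf.integrableOn.congr_fun_ae ?_) hg.integrableOn
  rw [EventuallyEq, ae_restrict_iff' measurableSet_Ioi]
  exact h.eq_right.mono fun t ht htx => ht (hx.trans_lt htx)

theorem integral_Iio_left (h : HasPiecewiseDeriv f g a b) (hf : Integrable f)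
    (hg : Integrable g) {x : ℝ} (hx : x ≤ 0) :
    ∫ t in Iio x, g t = b + ∫ t in (0 : ℝ)..x, g t := by
  refine h.isPrimitive_left.integral_Iio (hf.integrableOn.congr_fun_ae ?_) hg.integrableOn
  rw [EventuallyEq, ae_restrict_iff' measurableSet_Iio]
  exact h.eq_left.mono fun t ht htx => ht (lt_of_lt_of_le htx hx)

theorem integral_eq (h : HasPiecewiseDeriv f g a b) (hf : Integrable f) (hg : Integrable g) :
    ∫ x, g x = b - a := by
  rw [← intervalIntegral.integral_Iic_add_Ioi (b := 0) hg.integrableOn hg.integrableOn,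
    integral_Iic_eq_integral_Iio, h.integral_Ioi_right hf hg le_rfl,
    h.integral_Iio_left hf hg le_rfl]
  simp only [intervalIntegral.integral_same, add_zero]
  exact (sub_eq_add_neg b a).symm

theorem ae_norm_le_integral (h : HasPiecewiseDeriv f g a b) (hf : Integrable f)
    (hg : Integrable g) : ∀ᵐ x, ‖f x‖ ≤ ∫ t, ‖g t‖ := by
  have hset : ∀ s : Set ℝ, ‖∫ t in s, g t‖ ≤ ∫ t, ‖g t‖ := fun s =>
    (norm_integral_le_integral_norm _).trans
      (setIntegral_le_integral hg.norm (Eventually.of_forall fun _ => norm_nonneg _))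
  refine ae_of_ae_Ioi_of_ae_Iio (h.eq_right.mono fun x hx hx0 => ?_)
    (h.eq_left.mono fun x hx hx0 => ?_)
  · rw [hx hx0, ← norm_neg, ← h.integral_Ioi_right hf hg hx0.le]
    exact hset _
  · rw [hx hx0, ← h.integral_Iio_left hf hg hx0.le]
    exact hset _

end Integrable

end HasPiecewiseDeriv

theorem IsPrimitive.hasPiecewiseDeriv {E : Type*} [NormedAddCommGroup E] [NormedSpace ℝ E]
    {p g : ℝ → E} (hp : IsPrimitive p g) : HasPiecewiseDeriv p g (p 0) (p 0) :=
  HasPiecewiseDeriv.piecewise hp hp (by simp) (by simp) (by simp) (by simp)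

section WeakDerivative

variable {f g : L2R} {a b : ℂ}

theorem locallyIntegrable_L2R (f : L2R) : LocallyIntegrable f :=
  (Lp.memLp f).locallyIntegrable one_le_two

theorem HasPiecewiseDeriv.isWeakDeriv (h : HasPiecewiseDeriv f g a b) : IsWeakDeriv f g := by
  intro φ hφ hφc hφ0
  have hφ00 : φ 0 = 0 := image_eq_zero_of_notMem_tsupport fun h0 => hφ0 h0 rfl
  have hφf := integrable_smul_L2R hφ.continuous hφc f
  have hφg := integrable_smul_L2R hφ.continuous hφc g
  have hφ'f := integrable_smul_L2R (hφ.continuous_deriv (by simp)) hφc.deriv f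
  have hint := ((IsPrimitive.of_contDiff (hφ.of_le (by simp))).hasPiecewiseDeriv.smul h).integral_eq
    hφf (hφg.add hφ'f)
  rw [integral_add hφg hφ'f, hφ00, zero_smul, zero_smul, sub_zero] at hint
  exact eq_neg_of_add_eq_zero_right hint

theorem IsPrimitive.integral_deriv_smul {E : Type*} [NormedAddCommGroup E] [NormedSpace ℝ E]
    [CompleteSpace E] {p g : ℝ → E} (hp : IsPrimitive p g) {φ : ℝ → ℝ} (hφ : ContDiff ℝ 1 φ)
    (hφc : HasCompactSupport φ) : ∫ x, deriv φ x • p x = -∫ x, φ x • g x := by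
  have hφp := hp.continuous.locallyIntegrable.integrable_smul_left_of_hasCompactSupport
    (μ := volume) hφ.continuous hφc
  have hφg := hp.locallyIntegrable.integrable_smul_left_of_hasCompactSupport hφ.continuous hφc
  have hφ'p := hp.continuous.locallyIntegrable.integrable_smul_left_of_hasCompactSupport
    (μ := volume) (hφ.continuous_deriv le_rfl) hφc.deriv
  have hint := ((IsPrimitive.of_contDiff hφ).smul hp).hasPiecewiseDeriv.integral_eq
    hφp (hφg.add hφ'p)
  rw [integral_add hφg hφ'p, sub_self] at hint
  exact eq_neg_of_add_eq_zero_right hint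

theorem IsWeakDeriv.exists_ae_eq_const_add_integral (h : IsWeakDeriv f g) {U : Set ℝ}
    (hU : IsOpen U) (hc : U.OrdConnected) (hne : U.Nonempty) (h0 : (0 : ℝ) ∉ U) :
    ∃ c, ∀ᵐ x, x ∈ U → f x = c + ∫ t in (0 : ℝ)..x, g t := by
  have hG := IsPrimitive.const_add_integral (locallyIntegrable_L2R g) 0
  obtain ⟨c, hfc⟩ := ae_eq_const_of_integral_deriv_smul_eq_zero hU hc hne
    ((locallyIntegrable_L2R f).sub hG.continuous.locallyIntegrable)
    fun φ hφ hφc hφU => by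
      have hφ' := hφ.continuous_deriv (by simp)
      simp only [Pi.sub_apply, smul_sub]
      rw [integral_sub (integrable_smul_L2R hφ' hφc.deriv f)
        (hG.continuous.locallyIntegrable.integrable_smul_left_of_hasCompactSupport hφ' hφc.deriv),
        hG.integral_deriv_smul (hφ.of_le (by simp)) hφc,
        h φ hφ hφc (hφU.trans (subset_compl_singleton_iff.2 h0)), sub_self]
  refine ⟨c, hfc.mono fun x hx hxU => ?_⟩
  rw [← hx hxU, Pi.sub_apply, zero_add, sub_add_cancel]

theorem IsWeakDeriv.exists_hasPiecewiseDeriv (h : IsWeakDeriv f g) :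
    ∃ a b, HasPiecewiseDeriv f g a b := by
  obtain ⟨a, ha⟩ := h.exists_ae_eq_const_add_integral isOpen_Ioi ordConnected_Ioi nonempty_Ioi
    self_notMem_Ioi
  obtain ⟨b, hb⟩ := h.exists_ae_eq_const_add_integral isOpen_Iio ordConnected_Iio nonempty_Iio
    self_notMem_Iio
  exact ⟨a, b, locallyIntegrable_L2R g, ha, hb⟩

end WeakDerivative

section L2

theorem memLp_conj (f : L2R) : MemLp (fun x => starRingEnd ℂ (f x)) 2 volume :=
  (Lp.memLp f).star

theorem integrable_conj_mul (f g : L2R) : Integrable fun x => starRingEnd ℂ (f x) * g x :=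
  (memLp_conj f).integrable_mul (Lp.memLp g)

theorem inner_L2R (f g : L2R) : inner ℂ f g = ∫ x, starRingEnd ℂ (f x) * g x := by
  rw [L2.inner_def]
  exact integral_congr_ae (Eventually.of_forall fun x => mul_comm _ _)

theorem integrable_norm_sq_L2R (f : L2R) : Integrable fun x => ‖f x‖ ^ 2 :=
  (Lp.memLp f).integrable_norm_pow two_ne_zero

theorem integral_norm_sq_L2R (f : L2R) : ∫ x, ‖f x‖ ^ 2 = ‖f‖ ^ 2 := by
  have h : ((‖f‖ ^ 2 : ℝ) : ℂ) = ((∫ x, ‖f x‖ ^ 2 : ℝ) : ℂ) := by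
    rw [← integral_complex_ofReal, Complex.ofReal_pow]
    refine (inner_self_eq_norm_sq_to_K (𝕜 := ℂ) f).symm.trans ((inner_L2R f f).trans ?_)
    simp only [Complex.conj_mul', Complex.ofReal_pow]
  exact_mod_cast h.symm

theorem HasPiecewiseDeriv.conj_mul {f g u v : ℝ → ℂ} {a b c d : ℂ}
    (h : HasPiecewiseDeriv f g a b) (h' : HasPiecewiseDeriv u v c d) :
    HasPiecewiseDeriv (fun x => starRingEnd ℂ (f x) * u x)
      (fun x => starRingEnd ℂ (f x) * v x + starRingEnd ℂ (g x) * u x)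
      (starRingEnd ℂ a * c) (starRingEnd ℂ b * d) :=
  (h.clm_comp (Complex.conjCLE : ℂ →L[ℝ] ℂ)).smul h'

variable {f g : L2R} {a b : ℂ}

theorem HasPiecewiseDeriv.inner_add_inner {u v : L2R} {c d : ℂ} (h : HasPiecewiseDeriv f g a b)
    (h' : HasPiecewiseDeriv u v c d) :
    inner ℂ f v + inner ℂ g u = starRingEnd ℂ b * d - starRingEnd ℂ a * c := by
  rw [inner_L2R, inner_L2R, ← integral_add (integrable_conj_mul f v) (integrable_conj_mul g u)]
  exact (h.conj_mul h').integral_eq (integrable_conj_mul f u)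
    ((integrable_conj_mul f v).add (integrable_conj_mul g u))

/- The one-dimensional Sobolev inequality: `|f|²` has derivative `2 Re(f̄ f')`, whose `L¹` norm is
at most `k ‖f‖² + ‖f'‖² / k`. -/
theorem HasPiecewiseDeriv.ae_norm_sq_le (h : HasPiecewiseDeriv f g a b) {k : ℝ} (hk : 0 < k) :
    ∀ᵐ x, ‖f x‖ ^ 2 ≤ k * ‖f‖ ^ 2 + ‖g‖ ^ 2 / k := by
  have hi := (integrable_conj_mul f g).add (integrable_conj_mul g f)
  have hk' : Integrable fun x => k * ‖f x‖ ^ 2 + ‖g x‖ ^ 2 / k :=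
    ((integrable_norm_sq_L2R f).const_mul k).add ((integrable_norm_sq_L2R g).div_const k)
  have hbound : ∫ x, ‖starRingEnd ℂ (f x) * g x + starRingEnd ℂ (g x) * f x‖ ≤
      k * ‖f‖ ^ 2 + ‖g‖ ^ 2 / k := by
    rw [← integral_norm_sq_L2R f, ← integral_norm_sq_L2R g, ← integral_const_mul,
      ← integral_div, ← integral_add ((integrable_norm_sq_L2R f).const_mul k)
        ((integrable_norm_sq_L2R g).div_const k)]
    refine integral_mono hi.norm hk' fun x => (norm_add_le _ _).trans ?_
    rw [norm_mul, norm_mul, RCLike.norm_conj, RCLike.norm_conj]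
    have hsq : k * ‖f x‖ ^ 2 + ‖g x‖ ^ 2 / k - 2 * (‖f x‖ * ‖g x‖) =
        (k * ‖f x‖ - ‖g x‖) ^ 2 / k := by
      field_simp
      ring
    have hpos : 0 ≤ (k * ‖f x‖ - ‖g x‖) ^ 2 / k := by positivity
    linarith
  filter_upwards [(h.conj_mul h).ae_norm_le_integral (integrable_conj_mul f f) hi] with x hx
  rw [norm_mul, RCLike.norm_conj, ← sq] at hx
  exact hx.trans hbound

end L2

/-! ### The energy space and the quadratic form of the Hamiltonian -/

section EnergySpace

/-- The weak derivative on `ℝ \ {0}`, as a bounded operator `Q → L²(ℝ)`. -/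
def energyDeriv : EnergySpace →L[ℂ] L2R :=
  (WithLp.sndL 2 ℂ L2R L2R).comp EnergySpace.subtypeL

/-- The element of the energy space given by a function and its weak derivative. -/
def energyMk (f g : L2R) (h : IsWeakDeriv f g) : EnergySpace := ⟨WithLp.toLp 2 (f, g), h⟩

@[simp] theorem toL2_energyMk {f g : L2R} (h : IsWeakDeriv f g) : toL2 (energyMk f g h) = f := rfl

@[simp] theorem energyDeriv_energyMk {f g : L2R} (h : IsWeakDeriv f g) :
    energyDeriv (energyMk f g h) = g := rfl

theorem isWeakDeriv_energyDeriv (u : EnergySpace) : IsWeakDeriv (toL2 u) (energyDeriv u) := u.2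

theorem norm_sq_eq_add (u : EnergySpace) : ‖u‖ ^ 2 = ‖toL2 u‖ ^ 2 + ‖energyDeriv u‖ ^ 2 :=
  norm_sq_energySpace u

theorem norm_le_mul_norm_of_le {u w : EnergySpace} {c : ℝ} (hc : 0 ≤ c)
    (h : ‖toL2 w‖ ≤ c * ‖toL2 u‖) (h' : ‖energyDeriv w‖ ≤ c * ‖energyDeriv u‖) :
    ‖w‖ ≤ c * ‖u‖ := by
  refine le_of_sq_le_sq ?_ (by positivity)
  calc ‖w‖ ^ 2 = ‖toL2 w‖ ^ 2 + ‖energyDeriv w‖ ^ 2 := norm_sq_eq_add w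
    _ ≤ (c * ‖toL2 u‖) ^ 2 + (c * ‖energyDeriv u‖) ^ 2 := by gcongr
    _ = (c * ‖u‖) ^ 2 := by
        rw [mul_pow c ‖u‖, norm_sq_eq_add]
        ring

theorem ae_norm_sq_toL2_le (u : EnergySpace) {k : ℝ} (hk : 0 < k) :
    ∀ᵐ x, ‖toL2 u x‖ ^ 2 ≤ k * ‖toL2 u‖ ^ 2 + ‖energyDeriv u‖ ^ 2 / k := by
  obtain ⟨a, b, h⟩ := (isWeakDeriv_energyDeriv u).exists_hasPiecewiseDeriv
  exact h.ae_norm_sq_le hk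

theorem ae_norm_toL2_le (u : EnergySpace) : ∀ᵐ x, ‖toL2 u x‖ ≤ ‖u‖ := by
  filter_upwards [ae_norm_sq_toL2_le u one_pos] with x hx
  rw [one_mul, div_one, ← norm_sq_eq_add] at hx
  exact le_of_sq_le_sq hx (norm_nonneg u)

end EnergySpace

section Traces

theorem neBot_nhdsWithin_inf_ae {X : Type*} [TopologicalSpace X] [MeasurableSpace X]
    (μ : Measure X) [μ.IsOpenPosMeasure] {s : Set X} (hs : IsOpen s) {x : X}
    (hx : x ∈ closure s) : (𝓝[s] x ⊓ ae μ).NeBot := by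
  refine inf_neBot_iff.2 fun {V} hV {t} ht => ?_
  obtain ⟨U, hU, hxU, hUV⟩ := mem_nhdsWithin.1 hV
  have hne : (U ∩ s).Nonempty := mem_closure_iff.1 hx U hU hxU
  by_contra hempty
  have hsub : U ∩ s ⊆ tᶜ := fun y hy hyt => hempty ⟨y, hUV hy, hyt⟩
  exact ((hU.inter hs).measure_pos μ hne).ne' (measure_mono_null hsub (mem_ae_iff.1 ht))

instance : (𝓝[>] (0 : ℝ) ⊓ ae volume).NeBot :=
  neBot_nhdsWithin_inf_ae volume isOpen_Ioi (by simp)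

instance : (𝓝[<] (0 : ℝ) ⊓ ae volume).NeBot :=
  neBot_nhdsWithin_inf_ae volume isOpen_Iio (by simp)

/-- The bounded functional `u ↦ lim u` on `Q`, the limit being the essential one along a filter for
which it exists on all of `Q`. -/
def essLimit (l : Filter ℝ) [(l ⊓ ae volume).NeBot]
    (h : ∀ u : EnergySpace, ∃ a, Tendsto (toL2 u) (l ⊓ ae volume) (𝓝 a)) : EnergySpace →L[ℂ] ℂ :=
  LinearMap.mkContinuous
    { toFun := fun u => limUnder (l ⊓ ae volume) (toL2 u)
      map_add' := fun u v => by
        rw [map_add]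
        exact (trace_add (tendsto_nhds_limUnder (h u)) (tendsto_nhds_limUnder (h v))).limUnder_eq
      map_smul' := fun c u => by
        rw [map_smul]
        exact (trace_smul c (tendsto_nhds_limUnder (h u))).limUnder_eq }
    1 fun u => by
      rw [one_mul]
      exact le_of_tendsto (tendsto_nhds_limUnder (h u)).norm (mem_inf_of_right (ae_norm_toL2_le u))

/-- The trace `u ↦ u(0+)`. -/
def rightTrace : EnergySpace →L[ℂ] ℂ :=
  essLimit (𝓝[>] 0) fun u => by
    obtain ⟨a, b, h⟩ := (isWeakDeriv_energyDeriv u).exists_hasPiecewiseDeriv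
    exact ⟨a, h.tendsto_right⟩

/-- The trace `u ↦ u(0-)`. -/
def leftTrace : EnergySpace →L[ℂ] ℂ :=
  essLimit (𝓝[<] 0) fun u => by
    obtain ⟨a, b, h⟩ := (isWeakDeriv_energyDeriv u).exists_hasPiecewiseDeriv
    exact ⟨b, h.tendsto_left⟩

theorem rightTrace_eq {u : EnergySpace} {a : ℂ} (h : HasRightTrace (toL2 u) a) :
    rightTrace u = a := Tendsto.limUnder_eq h

theorem leftTrace_eq {u : EnergySpace} {a : ℂ} (h : HasLeftTrace (toL2 u) a) :
    leftTrace u = a := Tendsto.limUnder_eq h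

theorem hasPiecewiseDeriv_toL2 (u : EnergySpace) :
    HasPiecewiseDeriv (toL2 u) (energyDeriv u) (rightTrace u) (leftTrace u) := by
  obtain ⟨a, b, h⟩ := (isWeakDeriv_energyDeriv u).exists_hasPiecewiseDeriv
  rwa [rightTrace_eq h.tendsto_right, leftTrace_eq h.tendsto_left]

theorem hasRightTrace_rightTrace (u : EnergySpace) : HasRightTrace (toL2 u) (rightTrace u) :=
  (hasPiecewiseDeriv_toL2 u).tendsto_right

theorem hasLeftTrace_leftTrace (u : EnergySpace) : HasLeftTrace (toL2 u) (leftTrace u) :=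
  (hasPiecewiseDeriv_toL2 u).tendsto_left

theorem norm_sq_le_of_tendsto {u : EnergySpace} {l : Filter ℝ} [(l ⊓ ae volume).NeBot] {a : ℂ}
    (h : Tendsto (toL2 u) (l ⊓ ae volume) (𝓝 a)) {k : ℝ} (hk : 0 < k) :
    ‖a‖ ^ 2 ≤ k * ‖toL2 u‖ ^ 2 + ‖energyDeriv u‖ ^ 2 / k :=
  le_of_tendsto (h.norm.pow 2) (mem_inf_of_right (ae_norm_sq_toL2_le u hk))

theorem inner_energyDeriv_add (u v : EnergySpace) :
    inner ℂ (toL2 u) (energyDeriv v) + inner ℂ (energyDeriv u) (toL2 v) =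
      starRingEnd ℂ (leftTrace u) * leftTrace v - starRingEnd ℂ (rightTrace u) * rightTrace v :=
  (hasPiecewiseDeriv_toL2 u).inner_add_inner (hasPiecewiseDeriv_toL2 v)

theorem HasPiecewiseDeriv.exists_energySpace {f g : ℝ → ℂ} {a b : ℂ}
    (h : HasPiecewiseDeriv f g a b) (hf : MemLp f 2 volume) (hg : MemLp g 2 volume) :
    ∃ u : EnergySpace, toL2 u =ᵐ[volume] f ∧ energyDeriv u =ᵐ[volume] g ∧
      rightTrace u = a ∧ leftTrace u = b := by
  have hLp : HasPiecewiseDeriv hf.toLp hg.toLp a b :=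
    h.congr hf.coeFn_toLp.symm hg.coeFn_toLp.symm
  exact ⟨energyMk _ _ hLp.isWeakDeriv, hf.coeFn_toLp, hg.coeFn_toLp,
    rightTrace_eq hLp.tendsto_right, leftTrace_eq hLp.tendsto_left⟩

theorem exists_energySpace_of_contDiff {p q : ℝ → ℂ} (hp : ContDiff ℝ 1 p) (hq : ContDiff ℝ 1 q)
    (hpc : HasCompactSupport p) (hqc : HasCompactSupport q) :
    ∃ u : EnergySpace, toL2 u =ᵐ[volume] (Ioi 0).piecewise p q ∧
      energyDeriv u =ᵐ[volume] (Ioi 0).piecewise (deriv p) (deriv q) ∧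
      rightTrace u = p 0 ∧ leftTrace u = q 0 := by
  have hLp : ∀ {r : ℝ → ℂ}, Continuous r → HasCompactSupport r → ∀ s : Set ℝ,
      MemLp r 2 (volume.restrict s) := fun hr hrc s =>
    (hr.memLp_of_hasCompactSupport hrc).restrict s
  refine HasPiecewiseDeriv.exists_energySpace
    (.piecewise (.of_contDiff hp) (.of_contDiff hq) ?_ ?_ ?_ ?_)
    (.piecewise measurableSet_Ioi (hLp hp.continuous hpc _) (hLp hq.continuous hqc _))
    (.piecewise measurableSet_Ioi (hLp (hp.continuous_deriv le_rfl) hpc.deriv _)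
      (hLp (hq.continuous_deriv le_rfl) hqc.deriv _))
  all_goals refine Eventually.of_forall fun x hx => ?_
  · exact piecewise_eq_of_mem _ _ _ hx
  · exact piecewise_eq_of_notMem _ _ _ hx.not_gt
  · exact piecewise_eq_of_mem _ _ _ hx
  · exact piecewise_eq_of_notMem _ _ _ hx.not_gt

theorem exists_traces_eq (a b : ℂ) : ∃ u : EnergySpace, rightTrace u = a ∧ leftTrace u = b := by
  let η : ContDiffBump (0 : ℝ) := ⟨1, 2, one_pos, one_lt_two⟩
  have hη0 : η 0 = 1 := η.one_of_mem_closedBall (Metric.mem_closedBall_self zero_le_one)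
  obtain ⟨u, -, -, hR, hL⟩ := exists_energySpace_of_contDiff
    (p := fun x => η x • a) (q := fun x => η x • b) (η.contDiff.smul contDiff_const)
    (η.contDiff.smul contDiff_const) η.hasCompactSupport.smul_right η.hasCompactSupport.smul_right
  exact ⟨u, by rw [hR, hη0, one_smul], by rw [hL, hη0, one_smul]⟩

theorem exists_energySpace_of_test {φ : ℝ → ℝ} (hφ : ContDiff ℝ 1 φ) (hφc : HasCompactSupport φ) :
    ∃ u : EnergySpace, toL2 u =ᵐ[volume] (fun x => (φ x : ℂ)) ∧
      energyDeriv u =ᵐ[volume] (fun x => ((deriv φ x : ℝ) : ℂ)) ∧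
      rightTrace u = φ 0 ∧ leftTrace u = φ 0 := by
  have hφ' : ContDiff ℝ 1 fun x => (φ x : ℂ) := Complex.ofRealCLM.contDiff.comp hφ
  have hφc' : HasCompactSupport fun x => (φ x : ℂ) := hφc.comp_left Complex.ofReal_zero
  obtain ⟨u, hu, hu', hR, hL⟩ := exists_energySpace_of_contDiff hφ' hφ' hφc' hφc'
  rw [piecewise_same] at hu hu'
  refine ⟨u, hu, ?_, hR, hL⟩
  rwa [funext fun x => ((hφ.differentiable one_ne_zero x).hasDerivAt.ofReal_comp).deriv] at hu'

theorem isWeakDeriv_iff_inner {f g : L2R} : IsWeakDeriv f g ↔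
    ∀ v : EnergySpace, rightTrace v = 0 → leftTrace v = 0 →
      inner ℂ f (energyDeriv v) = -inner ℂ g (toL2 v) := by
  refine ⟨fun h v hR hL => ?_, fun h φ hφ hφc hφ0 => ?_⟩
  · have hgreen := inner_energyDeriv_add (energyMk f g h) v
    rw [hR, hL, mul_zero, mul_zero, sub_zero] at hgreen
    exact eq_neg_of_add_eq_zero_left hgreen
  · have hφ00 : φ 0 = 0 := image_eq_zero_of_notMem_tsupport fun h0 => hφ0 h0 rfl
    obtain ⟨v, hv, hv', hR, hL⟩ := exists_energySpace_of_test (hφ.of_le (by simp)) hφc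
    rw [hφ00, Complex.ofReal_zero] at hR hL
    have hinner : ∀ (ψ : ℝ → ℝ) (w k : L2R), w =ᵐ[volume] (fun x => (ψ x : ℂ)) →
        ∫ x, ψ x • k x = starRingEnd ℂ (inner ℂ k w) := fun ψ w k hw => by
      rw [inner_conj_symm, inner_L2R]
      refine integral_congr_ae (hw.mono fun x hx => ?_)
      simp only [hx, Complex.conj_ofReal, Complex.real_smul]
    rw [hinner _ _ f hv', hinner _ _ g hv, h v hR hL, map_neg]

theorem isClosed_energySpace : IsClosed (EnergySpace : Set (WithLp 2 (L2R × L2R))) := by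
  have heq : (EnergySpace : Set (WithLp 2 (L2R × L2R))) =
      ⋂ (v : EnergySpace) (_ : rightTrace v = 0) (_ : leftTrace v = 0),
        {u | inner ℂ u.fst (energyDeriv v) = -inner ℂ u.snd (toL2 v)} := by
    ext u
    simp only [mem_iInter]
    exact isWeakDeriv_iff_inner
  rw [heq]
  refine isClosed_iInter fun v => isClosed_iInter fun _ => isClosed_iInter fun _ =>
    isClosed_eq ?_ ?_
  · exact (WithLp.fstL 2 ℂ L2R L2R).continuous.inner continuous_const
  · exact ((WithLp.sndL 2 ℂ L2R L2R).continuous.inner continuous_const).neg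

instance : CompleteSpace EnergySpace := isClosed_energySpace.completeSpace_coe

theorem eq_zero_of_forall_inner_toL2 {f : L2R} (h : ∀ v, inner ℂ f (toL2 v) = 0) : f = 0 :=
  (isWeakDeriv_iff_inner.2 fun v _ _ => by rw [inner_zero_left, h, neg_zero]).eq_zero

end Traces

section QuadraticForm

/-- The jump `u ↦ u(0+) - u(0-)` at the origin. -/
def jump : EnergySpace →L[ℂ] ℂ := rightTrace - leftTrace

theorem jump_apply (u : EnergySpace) : jump u = rightTrace u - leftTrace u := rfl

theorem norm_sq_jump_le (u : EnergySpace) {k : ℝ} (hk : 0 < k) :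
    ‖jump u‖ ^ 2 ≤ 4 * (k * ‖toL2 u‖ ^ 2 + ‖energyDeriv u‖ ^ 2 / k) := by
  have hR := norm_sq_le_of_tendsto (hasRightTrace_rightTrace u) hk
  have hL := norm_sq_le_of_tendsto (hasLeftTrace_leftTrace u) hk
  calc ‖jump u‖ ^ 2 ≤ (‖rightTrace u‖ + ‖leftTrace u‖) ^ 2 := by
        gcongr
        exact norm_sub_le _ _
    _ ≤ 2 * (‖rightTrace u‖ ^ 2 + ‖leftTrace u‖ ^ 2) := add_sq_le
    _ ≤ 4 * (k * ‖toL2 u‖ ^ 2 + ‖energyDeriv u‖ ^ 2 / k) := by linarith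

open ContinuousLinearMap in
/-- The bounded operator on `Q` representing the quadratic form
`‖u'‖² + m ‖u‖² - γ⁻¹ |u(0+) - u(0-)|²` of `H_γ + m`. -/
def formOperator (γ m : ℝ) : EnergySpace →L[ℂ] EnergySpace :=
  (adjoint energyDeriv).comp energyDeriv + (adjoint toL2).comp ((m : ℂ) • toL2) -
    (adjoint jump).comp (((γ⁻¹ : ℝ) : ℂ) • jump)

theorem inner_formOperator (γ m : ℝ) (u v : EnergySpace) :
    inner ℂ (formOperator γ m u) v = inner ℂ (energyDeriv u) (energyDeriv v) +
      m * inner ℂ (toL2 u) (toL2 v) - (γ⁻¹ : ℝ) * (starRingEnd ℂ (jump u) * jump v) := by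
  simp only [formOperator, sub_apply, add_apply, smul_apply, ContinuousLinearMap.comp_apply,
    inner_sub_left, inner_add_left, inner_smul_left, ContinuousLinearMap.adjoint_inner_left,
    RCLike.inner_apply, Complex.conj_ofReal, smul_eq_mul, map_mul]
  ring

theorem inner_formOperator_symm (γ m : ℝ) (u v : EnergySpace) :
    inner ℂ (formOperator γ m u) v = inner ℂ u (formOperator γ m v) := by
  rw [← inner_conj_symm u, inner_formOperator, inner_formOperator]
  simp only [map_sub, map_add, map_mul, inner_conj_symm, Complex.conj_ofReal, Complex.conj_conj]
  ring

/-- A constant `m` for which the quadratic form of `H_γ + m` is coercive on `Q`. -/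
def formShift (γ : ℝ) : ℝ := 32 / γ ^ 2 + 1 / 2

theorem formOperator_coercive {γ : ℝ} (hγ : γ ≠ 0) (u : EnergySpace) :
    ‖u‖ ^ 2 / 2 ≤ (inner ℂ (formOperator γ (formShift γ) u) u).re := by
  have hform : inner ℂ (formOperator γ (formShift γ) u) u =
      ((‖energyDeriv u‖ ^ 2 + formShift γ * ‖toL2 u‖ ^ 2 - γ⁻¹ * ‖jump u‖ ^ 2 : ℝ) : ℂ) := by
    rw [inner_formOperator, inner_self_eq_norm_sq_to_K, inner_self_eq_norm_sq_to_K,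
      Complex.conj_mul']
    push_cast
    rfl
  have hγ' : 0 < |γ| := abs_pos.2 hγ
  have hjump : γ⁻¹ * ‖jump u‖ ^ 2 ≤ 32 / γ ^ 2 * ‖toL2 u‖ ^ 2 + ‖energyDeriv u‖ ^ 2 / 2 :=
    calc γ⁻¹ * ‖jump u‖ ^ 2 ≤ |γ|⁻¹ * ‖jump u‖ ^ 2 := by
          rw [← abs_inv]
          gcongr
          exact le_abs_self _
      _ ≤ |γ|⁻¹ * (4 * (8 / |γ| * ‖toL2 u‖ ^ 2 + ‖energyDeriv u‖ ^ 2 / (8 / |γ|))) := by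
          gcongr
          exact norm_sq_jump_le u (div_pos (by norm_num) hγ')
      _ = 32 / γ ^ 2 * ‖toL2 u‖ ^ 2 + ‖energyDeriv u‖ ^ 2 / 2 := by
          rw [← sq_abs γ]
          field_simp
          ring
  rw [hform, Complex.ofReal_re, norm_sq_eq_add, formShift]
  linarith

theorem isUnit_formOperator {γ : ℝ} (hγ : γ ≠ 0) : IsUnit (formOperator γ (formShift γ)) := by
  refine ContinuousLinearMap.isUnit_of_forall_le_norm_inner_map _ (c := 1 / 2) (by norm_num)
    fun u => ?_
  calc _ = ‖u‖ ^ 2 / 2 := by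
        rw [NNReal.coe_div, NNReal.coe_one, NNReal.coe_ofNat]
        ring
    _ ≤ (inner ℂ (formOperator γ (formShift γ) u) u).re := formOperator_coercive hγ u
    _ ≤ _ := (le_abs_self _).trans (Complex.abs_re_le_norm _)

theorem inner_formOperator_of_mem_hamiltonianGraph {γ : ℝ} (hγ : γ ≠ 0) (m : ℝ) {x y : L2R}
    (h : (x, y) ∈ hamiltonianGraph γ) : ∃ u, toL2 u = x ∧
      ∀ v, inner ℂ (formOperator γ m u) v = inner ℂ (y + (m : ℂ) • x) (toL2 v) := by
  obtain ⟨x', hx, hx', a, b, c, ha, hb, hcR, hcL, hjump⟩ := h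
  set u := energyMk x x' hx
  set w := energyMk x' (-y) hx'
  refine ⟨u, rfl, fun v => ?_⟩
  have hgreen : inner ℂ x' (energyDeriv v) + inner ℂ (-y) (toL2 v) =
      starRingEnd ℂ (leftTrace w) * leftTrace v - starRingEnd ℂ (rightTrace w) * rightTrace v :=
    inner_energyDeriv_add w v
  rw [rightTrace_eq (u := w) hcR, leftTrace_eq (u := w) hcL, inner_neg_left] at hgreen
  have hu : jump u = -(γ : ℂ) * c := by
    rw [jump_apply, rightTrace_eq (u := u) ha, leftTrace_eq (u := u) hb, hjump]
  have hγ' : (γ : ℂ) ≠ 0 := Complex.ofReal_ne_zero.2 hγ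
  rw [inner_formOperator, hu, toL2_energyMk, energyDeriv_energyMk, inner_add_left,
    inner_smul_left, Complex.conj_ofReal, jump_apply]
  simp only [map_mul, map_neg, Complex.conj_ofReal, Complex.ofReal_inv]
  field_simp
  linear_combination hgreen

/- The conditions on the derivative at the origin are the natural boundary conditions of the form:
they are read off from Green's formula, the traces of the test function `v` being arbitrary. -/
theorem mem_hamiltonianGraph_of_inner {γ : ℝ} (hγ : γ ≠ 0) {u : EnergySpace} {y : L2R}
    (h : ∀ v, inner ℂ (energyDeriv u) (energyDeriv v) =
      inner ℂ y (toL2 v) + (γ⁻¹ : ℝ) * (starRingEnd ℂ (jump u) * jump v)) :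
    (toL2 u, y) ∈ hamiltonianGraph γ := by
  have hderiv : IsWeakDeriv (energyDeriv u) (-y) := isWeakDeriv_iff_inner.2 fun v hR hL => by
    rw [h v, jump_apply v, hR, hL, sub_zero, mul_zero, mul_zero, add_zero, inner_neg_left, neg_neg]
  set w := energyMk (energyDeriv u) (-y) hderiv
  have hboundary : ∀ v, starRingEnd ℂ (leftTrace w) * leftTrace v -
      starRingEnd ℂ (rightTrace w) * rightTrace v =
        (γ⁻¹ : ℝ) * (starRingEnd ℂ (jump u) * jump v) := fun v => by
    rw [← inner_energyDeriv_add w v, toL2_energyMk, energyDeriv_energyMk, inner_neg_left, h v]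
    ring
  have hR : rightTrace w = -(γ⁻¹ : ℝ) * jump u := by
    obtain ⟨v, hv, hv'⟩ := exists_traces_eq 1 0
    have hw := hboundary v
    rw [jump_apply v, hv, hv'] at hw
    apply (starRingEnd ℂ).injective
    rw [map_mul, map_neg, Complex.conj_ofReal]
    linear_combination -hw
  have hL : leftTrace w = -(γ⁻¹ : ℝ) * jump u := by
    obtain ⟨v, hv, hv'⟩ := exists_traces_eq 0 1
    have hw := hboundary v
    rw [jump_apply v, hv, hv'] at hw
    apply (starRingEnd ℂ).injective
    rw [map_mul, map_neg, Complex.conj_ofReal]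
    linear_combination hw
  have hγ' : (γ : ℂ) ≠ 0 := Complex.ofReal_ne_zero.2 hγ
  refine ⟨energyDeriv u, isWeakDeriv_energyDeriv u, hderiv, rightTrace u, leftTrace u, _,
    hasRightTrace_rightTrace u, hasLeftTrace_leftTrace u, hasRightTrace_rightTrace w,
    hR.trans hL.symm ▸ hasLeftTrace_leftTrace w, ?_⟩
  rw [hR, ← jump_apply, Complex.ofReal_inv]
  field_simp

theorem mem_hamiltonianGraph_iff {γ : ℝ} (hγ : γ ≠ 0) (m : ℝ) (x y : L2R) :
    (x, y) ∈ hamiltonianGraph γ ↔ ∃ u, toL2 u = x ∧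
      ∀ v, inner ℂ (formOperator γ m u) v = inner ℂ (y + (m : ℂ) • x) (toL2 v) := by
  refine ⟨inner_formOperator_of_mem_hamiltonianGraph hγ m, ?_⟩
  rintro ⟨u, rfl, h⟩
  refine mem_hamiltonianGraph_of_inner hγ fun v => ?_
  have hv := h v
  rw [inner_formOperator, inner_add_left, inner_smul_left, Complex.conj_ofReal] at hv
  linear_combination hv

end QuadraticForm

/-! ### Unitary groups from self-adjoint resolvents -/

section Dense

variable {𝕜 E F : Type*} [NontriviallyNormedField 𝕜] [NormedAddCommGroup E] [NormedSpace 𝕜 E]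
  [NormedAddCommGroup F] [NormedSpace 𝕜 F]

theorem exists_mem_mul_norm_sub_lt {s : Set E} (hs : Dense s) (x : E) (C : ℝ) {ε : ℝ}
    (hε : 0 < ε) : ∃ y ∈ s, C * ‖x - y‖ < ε :=
  hs.exists_mem_open (U := {y | C * ‖x - y‖ < ε})
    (isOpen_lt (continuous_const.mul (continuous_const.sub continuous_id).norm) continuous_const)
    ⟨x, by simpa using hε⟩

theorem continuous_apply_of_dense {ι : Type*} [TopologicalSpace ι] {U : ι → E →L[𝕜] F} {C : ℝ}
    (hU : ∀ i, ‖U i‖ ≤ C) {s : Set E} (hs : Dense s) (h : ∀ x ∈ s, Continuous fun i => U i x)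
    (x : E) : Continuous fun i => U i x := by
  refine continuous_of_uniform_approx_of_continuous fun u hu => ?_
  obtain ⟨ε, hε, hεu⟩ := Metric.mem_uniformity_dist.1 hu
  obtain ⟨y, hy, hxy⟩ := exists_mem_mul_norm_sub_lt hs x C hε
  refine ⟨fun i => U i y, h y hy, fun i => hεu ?_⟩
  rw [dist_eq_norm, ← map_sub]
  exact ((U i).le_of_opNorm_le (hU i) _).trans_lt hxy

theorem hasDerivAt_apply_of_dense [NormedSpace ℝ F] {U : ℝ → E →L[𝕜] F} {U' : E →L[𝕜] F} {C t₀ : ℝ}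
    (hU : ∀ t, ‖U t - U t₀‖ ≤ C * |t - t₀|) {s : Set E} (hs : Dense s)
    (h : ∀ x ∈ s, HasDerivAt (fun t => U t x) (U' x) t₀) (x : E) :
    HasDerivAt (fun t => U t x) (U' x) t₀ := by
  refine hasDerivAt_iff_isLittleO.2 (Asymptotics.isLittleO_iff.2 fun ε hε => ?_)
  obtain ⟨y, hy, hxy⟩ := exists_mem_mul_norm_sub_lt hs x (C + ‖U'‖) (half_pos hε)
  filter_upwards [Asymptotics.isLittleO_iff.1 (hasDerivAt_iff_isLittleO.1 (h y hy))
    (half_pos hε)] with t ht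
  rw [Real.norm_eq_abs] at ht ⊢
  have hsplit : U t x - U t₀ x - (t - t₀) • U' x = (U t - U t₀) (x - y) -
      (t - t₀) • U' (x - y) + (U t y - U t₀ y - (t - t₀) • U' y) := by
    simp only [sub_apply, map_sub, smul_sub]
    abel
  calc ‖U t x - U t₀ x - (t - t₀) • U' x‖
      ≤ C * |t - t₀| * ‖x - y‖ + |t - t₀| * (‖U'‖ * ‖x - y‖) + ε / 2 * |t - t₀| := by
        rw [hsplit]
        refine norm_add_le_of_le (norm_sub_le_of_le ((U t - U t₀).le_of_opNorm_le (hU t) _) ?_) ht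
        rw [norm_smul, Real.norm_eq_abs]
        gcongr
        exact U'.le_opNorm _
    _ = |t - t₀| * ((C + ‖U'‖) * ‖x - y‖ + ε / 2) := by ring
    _ ≤ |t - t₀| * (ε / 2 + ε / 2) := by gcongr
    _ = ε * |t - t₀| := by ring

theorem isRightRegular_of_denseRange {K : E →L[𝕜] E} (hK : DenseRange K) : IsRightRegular K :=
  fun A B h => DFunLike.coe_injective <| hK.equalizer A.continuous B.continuous <|
    congrArg DFunLike.coe h

end Dense

section PhaseMul

open Complex

/-- The multiplier `z ↦ z e^{-it(1/z - m)}`, regular at `z = 0`. Only its values on the real axis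
matter; taking the real part of `1/z` makes it continuous on `ℂ`. -/
def phaseMul (m t : ℝ) (z : ℂ) : ℂ := z * Circle.exp (-(t * ((z⁻¹).re - m)))

theorem norm_phaseMul (m t : ℝ) (z : ℂ) : ‖phaseMul m t z‖ = ‖z‖ := by
  rw [phaseMul, norm_mul, Circle.norm_coe, mul_one]

theorem phaseMul_zero (m : ℝ) : phaseMul m 0 = id := by
  ext z
  simp [phaseMul]

@[fun_prop]
theorem continuous_phaseMul (m t : ℝ) : Continuous (phaseMul m t) := by
  refine continuous_iff_continuousAt.2 fun z => ?_
  rcases eq_or_ne z 0 with rfl | hz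
  · have hzero : phaseMul m t 0 = 0 := by simp [phaseMul]
    rw [ContinuousAt, hzero, tendsto_zero_iff_norm_tendsto_zero]
    simp only [norm_phaseMul]
    exact tendsto_norm_zero
  · have hinv : ContinuousAt (fun z : ℂ => -(t * ((z⁻¹).re - m))) z :=
      (((continuous_re.continuousAt.comp (continuousAt_inv₀ hz)).sub
        continuousAt_const).const_mul t).neg
    exact continuousAt_id.mul
      ((continuous_subtype_val.comp Circle.exp.continuous).continuousAt.comp hinv)

theorem phaseMul_mul (m s t : ℝ) (z : ℂ) :
    phaseMul m s z * phaseMul m t z = z * phaseMul m (s + t) z := by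
  have hexp : Circle.exp (-((s + t) * ((z⁻¹).re - m))) =
      Circle.exp (-(s * ((z⁻¹).re - m))) * Circle.exp (-(t * ((z⁻¹).re - m))) := by
    rw [← Circle.exp_add]
    congr 1
    ring
  simp only [phaseMul, hexp, Circle.coe_mul]
  ring

theorem star_phaseMul_mul (m t : ℝ) (z : ℂ) :
    star (phaseMul m t z) * phaseMul m t z = star z * z := by
  simp only [star_def, conj_mul', norm_phaseMul]

theorem norm_phaseMul_sub_le (m s t : ℝ) (z : ℂ) :
    ‖phaseMul m t z - phaseMul m s z‖ ≤ (1 + |m| * ‖z‖) * |t - s| := by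
  rcases eq_or_ne z 0 with rfl | hz
  · simp [phaseMul]
  set θ : ℝ := (z⁻¹).re - m
  have hexp : (Circle.exp (-(t * θ)) : ℂ) =
      Circle.exp (-(s * θ)) * exp (I * ((-((t - s) * θ) : ℝ) : ℂ)) := by
    rw [Circle.coe_exp, Circle.coe_exp, ← exp_add]
    congr 1
    push_cast
    ring
  have hθ : ‖z‖ * |θ| ≤ 1 + |m| * ‖z‖ :=
    calc ‖z‖ * |θ| ≤ ‖z‖ * (‖z⁻¹‖ + |m|) := by
          gcongr
          exact (abs_sub _ _).trans (add_le_add_left (abs_re_le_norm _) _)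
      _ = 1 + |m| * ‖z‖ := by
          rw [norm_inv, mul_add, mul_inv_cancel₀ (norm_ne_zero_iff.2 hz), mul_comm |m|]
  calc ‖phaseMul m t z - phaseMul m s z‖
      = ‖phaseMul m s z * (exp (I * ((-((t - s) * θ) : ℝ) : ℂ)) - 1)‖ := by
        simp only [phaseMul]
        rw [hexp]
        congr 1
        ring
    _ ≤ ‖z‖ * ‖-((t - s) * θ)‖ := by
        rw [norm_mul, norm_phaseMul]
        gcongr
        exact Real.norm_exp_I_mul_ofReal_sub_one_le
    _ = ‖z‖ * |θ| * |t - s| := by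
        rw [norm_neg, norm_mul, Real.norm_eq_abs, Real.norm_eq_abs]
        ring
    _ ≤ (1 + |m| * ‖z‖) * |t - s| := by gcongr

theorem norm_circleExp_sub_one_sub_le (θ : ℝ) : ‖(Circle.exp θ : ℂ) - 1 - θ * I‖ ≤ 3 * θ ^ 2 := by
  have hθ : ‖(θ : ℂ) * I‖ = |θ| := by simp
  rcases le_or_gt |θ| 1 with hle | hgt
  · have hexp := norm_exp_sub_one_sub_id_le (x := (θ : ℂ) * I) (hθ.trans_le hle)
    rw [hθ, sq_abs] at hexp
    exact hexp.trans (by linarith [sq_nonneg θ])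
  · calc ‖(Circle.exp θ : ℂ) - 1 - θ * I‖ ≤ 1 + 1 + |θ| :=
          norm_sub_le_of_le (norm_sub_le_of_le (Circle.norm_coe _).le norm_one.le) hθ.le
      _ ≤ 3 * |θ| ^ 2 := by nlinarith
      _ = 3 * θ ^ 2 := by rw [sq_abs]

theorem norm_phaseMul_mul_sub_le (m t : ℝ) {z : ℂ} (hz : z = z.re) :
    ‖phaseMul m t z * z - z * z + (t * I) * (z - m * (z * z))‖ ≤
      3 * (1 + |m| * ‖z‖) ^ 2 * t ^ 2 := by
  rw [hz]
  generalize z.re = x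
  rcases eq_or_ne x 0 with rfl | hx
  · suffices 0 ≤ 3 * t ^ 2 by simpa [phaseMul] using this
    positivity
  have hx' : (x : ℂ) ≠ 0 := ofReal_ne_zero.2 hx
  set θ : ℝ := -(t * (x⁻¹ - m)) with hθ
  have hfactor : phaseMul m t x * x - x * x + (t * I) * (x - m * (x * x)) =
      (x * x) * ((Circle.exp θ : ℂ) - 1 - θ * I) := by
    rw [phaseMul, ← ofReal_inv, ofReal_re, ← hθ, hθ]
    push_cast
    field_simp
    ring
  calc _ ≤ ‖(x : ℂ) * x‖ * (3 * θ ^ 2) := by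
        rw [hfactor, norm_mul]
        gcongr
        exact norm_circleExp_sub_one_sub_le θ
    _ = 3 * |1 - m * x| ^ 2 * t ^ 2 := by
        rw [norm_mul, norm_real, ← sq, Real.norm_eq_abs, sq_abs, sq_abs, hθ]
        field_simp
    _ ≤ 3 * (1 + |m| * ‖(x : ℂ)‖) ^ 2 * t ^ 2 := by
        gcongr
        rw [norm_real, Real.norm_eq_abs, ← abs_mul]
        exact (abs_sub 1 (m * x)).trans_eq (by rw [abs_one])

end PhaseMul

section Generation

variable {E : Type*} [NormedAddCommGroup E] [InnerProductSpace ℂ E] [CompleteSpace E]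

/-- The operator `K e^{-it(1/K - m)}` for a bounded self-adjoint operator `K`. -/
def phaseOp (K : E →L[ℂ] E) (m t : ℝ) : E →L[ℂ] E := cfc (phaseMul m t) K

/-- The operator `e^{-it(1/K - m)}`, for a bounded self-adjoint operator `K` with dense range: the
extension by continuity of `K x ↦ K e^{-it(1/K - m)} x`. -/
def phaseGroup (K : E →L[ℂ] E) (m t : ℝ) : E →L[ℂ] E :=
  LinearMap.extendOfNorm (phaseOp K m t : E →ₗ[ℂ] E) (K : E →ₗ[ℂ] E)

variable {K : E →L[ℂ] E}

theorem phaseOp_zero (hK : IsSelfAdjoint K) (m : ℝ) : phaseOp K m 0 = K := by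
  rw [phaseOp, phaseMul_zero, cfc_id ℂ K hK.isStarNormal]

theorem phaseOp_mul (hK : IsSelfAdjoint K) (m s t : ℝ) :
    phaseOp K m s * phaseOp K m t = K * phaseOp K m (s + t) := by
  have hnormal := hK.isStarNormal
  calc phaseOp K m s * phaseOp K m t = cfc (fun z => id z * phaseMul m (s + t) z) K := by
        rw [phaseOp, phaseOp, ← cfc_mul (phaseMul m s) (phaseMul m t) K]
        simp only [phaseMul_mul, id]
    _ = K * phaseOp K m (s + t) := by
        rw [cfc_mul id (phaseMul m (s + t)) K, cfc_id ℂ K hnormal, phaseOp]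

theorem phaseOp_mul_self (hK : IsSelfAdjoint K) (m t : ℝ) :
    phaseOp K m t * K = K * phaseOp K m t := by
  have hmul := phaseOp_mul hK m t 0
  rwa [phaseOp_zero hK, add_zero] at hmul

theorem star_phaseOp_mul (hK : IsSelfAdjoint K) (m t : ℝ) :
    star (phaseOp K m t) * phaseOp K m t = star K * K := by
  have hnormal := hK.isStarNormal
  calc star (phaseOp K m t) * phaseOp K m t =
        cfc (fun z => star (phaseMul m t z) * phaseMul m t z) K := by
        rw [phaseOp, ← cfc_star, ← cfc_mul (fun z => star (phaseMul m t z)) (phaseMul m t) K]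
    _ = cfc (fun z => star (id z) * id z) K := cfc_congr fun z _ => star_phaseMul_mul m t z
    _ = star K * K := by
        rw [cfc_mul (fun z => star (id z)) id K, cfc_star, cfc_id ℂ K hnormal]

theorem norm_phaseOp_apply (hK : IsSelfAdjoint K) (m t : ℝ) (x : E) :
    ‖phaseOp K m t x‖ = ‖K x‖ := by
  have hsq : ∀ A : E →L[ℂ] E, ‖A x‖ ^ 2 = (inner ℂ ((star A * A) x) x).re := fun A =>
    A.apply_norm_sq_eq_inner_adjoint_left x
  rw [← sq_eq_sq₀ (norm_nonneg _) (norm_nonneg _), hsq, hsq, star_phaseOp_mul hK]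

theorem norm_le_of_mem_spectrum (hK : IsSelfAdjoint K) {z : ℂ} (hz : z ∈ spectrum ℂ K) :
    ‖z‖ ≤ ‖K‖ := by
  have hnormal := hK.isStarNormal
  have h := norm_apply_le_norm_cfc id K hz
  rwa [cfc_id ℂ K hnormal] at h

theorem norm_phaseOp_sub_le (hK : IsSelfAdjoint K) (m s t : ℝ) :
    ‖phaseOp K m t - phaseOp K m s‖ ≤ (1 + |m| * ‖K‖) * |t - s| := by
  rw [phaseOp, phaseOp, ← cfc_sub (phaseMul m t) (phaseMul m s) K]
  refine norm_cfc_le (by positivity) fun z hz => (norm_phaseMul_sub_le _ _ _ _).trans ?_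
  gcongr
  exact norm_le_of_mem_spectrum hK hz

theorem norm_phaseOp_mul_sub_le (hK : IsSelfAdjoint K) (m t : ℝ) :
    ‖phaseOp K m t * K - K * K + (t * Complex.I) • (K - (m : ℂ) • (K * K))‖ ≤
      3 * (1 + |m| * ‖K‖) ^ 2 * t ^ 2 := by
  have hnormal := hK.isStarNormal
  have hcfc : phaseOp K m t * K - K * K + (t * Complex.I) • (K - (m : ℂ) • (K * K)) =
      cfc (fun z => phaseMul m t z * z - z * z + (t * Complex.I) * (z - m * (z * z))) K := by
    rw [cfc_add K (fun z => phaseMul m t z * z - z * z) _,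
      cfc_sub (fun z => phaseMul m t z * z) _ K, cfc_mul (phaseMul m t) _ K,
      cfc_const_mul _ (fun z : ℂ => z - m * (z * z)) K, cfc_sub _ (fun z : ℂ => m * (z * z)) K,
      cfc_const_mul _ (fun z : ℂ => z * z) K, cfc_mul _ _ K, cfc_id' ℂ K hnormal, phaseOp]
  rw [hcfc]
  refine norm_cfc_le (by positivity) fun z hz =>
    (norm_phaseMul_mul_sub_le m t (hK.mem_spectrum_eq_re hz)).trans ?_
  gcongr
  exact norm_le_of_mem_spectrum hK hz

theorem hasDerivAt_phaseOp_mul (hK : IsSelfAdjoint K) (m : ℝ) :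
    HasDerivAt (fun t => phaseOp K m t * K) (-(Complex.I • (K - (m : ℂ) • (K * K)))) 0 := by
  rw [hasDerivAt_iff_isLittleO]
  refine Asymptotics.IsBigO.trans_isLittleO (g := fun t : ℝ => t ^ 2) ?_ ?_
  · refine Asymptotics.IsBigO.of_bound (3 * (1 + |m| * ‖K‖) ^ 2) (Eventually.of_forall fun t => ?_)
    rw [Real.norm_eq_abs, abs_of_nonneg (sq_nonneg t), phaseOp_zero hK, sub_zero, smul_neg,
      sub_neg_eq_add, ← Complex.coe_smul, smul_smul]
    exact norm_phaseOp_mul_sub_le hK m t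
  · simpa only [sub_zero] using Asymptotics.isLittleO_pow_id (𝕜 := ℝ) one_lt_two

theorem hasDerivAt_phaseOp_apply (hK : IsSelfAdjoint K) (hdense : DenseRange K) (m : ℝ) (x : E) :
    HasDerivAt (fun t => phaseOp K m t x) (-(Complex.I • (x - (m : ℂ) • K x))) 0 := by
  refine hasDerivAt_apply_of_dense (U' := -(Complex.I • (1 - (m : ℂ) • K)))
    (fun t => norm_phaseOp_sub_le hK m 0 t) hdense ?_ x
  rintro _ ⟨y, rfl⟩
  exact (((ContinuousLinearMap.apply ℂ E y).restrictScalars ℝ).hasFDerivAt.comp_hasDerivAt (0 : ℝ)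
    (hasDerivAt_phaseOp_mul hK m) :)

theorem phaseGroup_mul_self (hK : IsSelfAdjoint K) (hdense : DenseRange K) (m t : ℝ) :
    phaseGroup K m t * K = phaseOp K m t :=
  ContinuousLinearMap.ext fun x => LinearMap.extendOfNorm_eq hdense
    ⟨1, fun x => ((norm_phaseOp_apply hK m t x).trans (one_mul _).symm).le⟩ x

theorem phaseGroup_apply (hK : IsSelfAdjoint K) (hdense : DenseRange K) (m t : ℝ) (x : E) :
    phaseGroup K m t (K x) = phaseOp K m t x :=
  DFunLike.congr_fun (phaseGroup_mul_self hK hdense m t) x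

theorem norm_phaseGroup_apply (hK : IsSelfAdjoint K) (hdense : DenseRange K) (m t : ℝ) (x : E) :
    ‖phaseGroup K m t x‖ = ‖x‖ := by
  refine congrFun (hdense.equalizer (phaseGroup K m t).continuous.norm continuous_norm
    (funext fun y => ?_)) x
  simp only [Function.comp_apply, phaseGroup_apply hK hdense, norm_phaseOp_apply hK]

theorem self_mul_phaseGroup (hK : IsSelfAdjoint K) (hdense : DenseRange K) (m t : ℝ) :
    K * phaseGroup K m t = phaseGroup K m t * K := by
  refine isRightRegular_of_denseRange hdense ?_
  simp only [mul_assoc, phaseGroup_mul_self hK hdense, phaseOp_mul_self hK]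

theorem phaseGroup_zero (hK : IsSelfAdjoint K) (hdense : DenseRange K) (m : ℝ) :
    phaseGroup K m 0 = 1 := by
  refine isRightRegular_of_denseRange hdense ?_
  simp only [phaseGroup_mul_self hK hdense, phaseOp_zero hK, one_mul]

theorem phaseGroup_add (hK : IsSelfAdjoint K) (hdense : DenseRange K) (m s t : ℝ) :
    phaseGroup K m (s + t) = phaseGroup K m s * phaseGroup K m t := by
  refine isRightRegular_of_denseRange hdense (isRightRegular_of_denseRange hdense ?_)
  calc phaseGroup K m (s + t) * K * K = phaseOp K m s * phaseOp K m t := by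
        rw [phaseGroup_mul_self hK hdense, phaseOp_mul_self hK, phaseOp_mul hK]
    _ = phaseGroup K m s * phaseGroup K m t * K * K := by
        rw [← phaseGroup_mul_self hK hdense, ← phaseGroup_mul_self hK hdense, mul_assoc,
          ← mul_assoc K, self_mul_phaseGroup hK hdense, mul_assoc, mul_assoc, mul_assoc]

theorem continuous_phaseGroup_apply (hK : IsSelfAdjoint K) (hdense : DenseRange K) (m : ℝ) (x : E) :
    Continuous fun t => phaseGroup K m t x := by
  refine continuous_apply_of_dense (C := 1) (fun t => ?_) hdense ?_ x
  · exact ContinuousLinearMap.opNorm_le_bound _ zero_le_one fun x => by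
      rw [one_mul, norm_phaseGroup_apply hK hdense]
  · rintro _ ⟨y, rfl⟩
    simp only [phaseGroup_apply hK hdense]
    have hlip : LipschitzWith (Real.toNNReal (1 + |m| * ‖K‖)) (phaseOp K m) :=
      LipschitzWith.of_dist_le' fun t s => by
        rw [dist_eq_norm, Real.dist_eq]
        exact norm_phaseOp_sub_le hK m s t
    exact hlip.continuous.clm_apply continuous_const

theorem mem_unitary_of_norm_map_of_mul_eq_one {A B : E →L[ℂ] E} (hA : ∀ x, ‖A x‖ = ‖x‖)
    (hAB : A * B = 1) : A ∈ unitary (E →L[ℂ] E) := by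
  have hstar : star A * A = 1 := (ContinuousLinearMap.norm_map_iff_adjoint_comp_self A).1 hA
  have hB : star A = B := left_inv_eq_right_inv hstar hAB
  exact Unitary.mem_iff.2 ⟨hstar, hB ▸ hAB⟩

theorem isUnitaryGroupOf_phaseGroup (hK : IsSelfAdjoint K) (hdense : DenseRange K) (m : ℝ)
    {T : E →ₗ.[ℂ] E} (hT : ∀ x y, (x, y) ∈ T.graph ↔ x = K (y + (m : ℂ) • x)) :
    IsUnitaryGroupOf T (phaseGroup K m) where
  mem_unitary t := mem_unitary_of_norm_map_of_mul_eq_one (norm_phaseGroup_apply hK hdense m t) <| by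
    rw [← phaseGroup_add hK hdense m t (-t), add_neg_cancel, phaseGroup_zero hK hdense]
  map_zero := phaseGroup_zero hK hdense m
  map_add := phaseGroup_add hK hdense m
  continuous := continuous_phaseGroup_apply hK hdense m
  generator x y := by
    have hderiv := hasDerivAt_phaseOp_apply hK hdense m
    simp only [← phaseGroup_apply hK hdense] at hderiv
    rw [hT]
    refine ⟨fun hxy => ?_, fun hxy => ?_⟩
    · have hx := hderiv (y + (m : ℂ) • x)
      rwa [← hxy, add_sub_cancel_right] at hx
    · have hKx : HasDerivAt (fun t => phaseGroup K m t (K x)) (K (-(Complex.I • y))) 0 :=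
        ((K.restrictScalars ℝ).hasFDerivAt.comp_hasDerivAt (0 : ℝ) hxy).congr_of_eventuallyEq <|
          Eventually.of_forall fun t =>
            DFunLike.congr_fun (self_mul_phaseGroup hK hdense m t).symm x
      have huniq := (hderiv x).unique hKx
      rw [map_neg, map_smul, neg_inj] at huniq
      have hKy : x - (m : ℂ) • K x = K y := smul_right_injective E Complex.I_ne_zero huniq
      rw [map_add, map_smul, ← hKy, sub_add_cancel]

end Generation

namespace IsUnitaryGroupOf

variable {E : Type*} [NormedAddCommGroup E] [InnerProductSpace ℂ E] [CompleteSpace E]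
  {A : E →ₗ.[ℂ] E} {U : ℝ → E →L[ℂ] E}

theorem apply_add (h : IsUnitaryGroupOf A U) (s t : ℝ) (x : E) : U (s + t) x = U s (U t x) := by
  rw [h.map_add, mul_apply_eq_comp]

theorem inner_apply_apply (h : IsUnitaryGroupOf A U) (t : ℝ) (x y : E) :
    inner ℂ (U t x) (U t y) = inner ℂ x y :=
  ContinuousLinearMap.inner_map_map_of_mem_unitary (h.mem_unitary t) x y

theorem hasDerivAt_comp (h : IsUnitaryGroupOf A U) {x y : E} (hxy : (x, y) ∈ A.graph) (t : ℝ) :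
    HasDerivAt (fun s => U t (U s x)) (-(Complex.I • U t y)) 0 := by
  have hderiv := ((U t).restrictScalars ℝ).hasFDerivAt.comp_hasDerivAt (0 : ℝ)
    ((h.generator x y).1 hxy)
  rwa [ContinuousLinearMap.coe_restrictScalars', map_neg, map_smul] at hderiv

theorem hasDerivAt (h : IsUnitaryGroupOf A U) {x y : E} (hxy : (x, y) ∈ A.graph) (t : ℝ) :
    HasDerivAt (fun t => U t x) (-(Complex.I • U t y)) t := by
  have hderiv := h.hasDerivAt_comp hxy t
  rw [← sub_self t] at hderiv
  refine (hderiv.comp_sub_const t t).congr_of_eventuallyEq (Eventually.of_forall fun s => ?_)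
  simp only [← h.apply_add, add_sub_cancel]

theorem apply_mem_graph (h : IsUnitaryGroupOf A U) {x y : E} (hxy : (x, y) ∈ A.graph) (t : ℝ) :
    (U t x, U t y) ∈ A.graph := by
  refine (h.generator _ _).2 ((h.hasDerivAt_comp hxy t).congr_of_eventuallyEq
    (Eventually.of_forall fun s => ?_))
  simp only [← h.apply_add, add_comm]

end IsUnitaryGroupOf

/-! ### The propagator on the energy space -/

section Resolvent

theorem denseRange_of_forall_inner {E F : Type*} [NormedAddCommGroup E] [InnerProductSpace ℂ E]
    [NormedAddCommGroup F] [InnerProductSpace ℂ F] [CompleteSpace F] (T : E →L[ℂ] F)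
    (h : ∀ y, (∀ x, inner ℂ (T x) y = 0) → y = 0) : DenseRange T := by
  have horth : T.rangeᗮ = ⊥ := (Submodule.eq_bot_iff _).2 fun y hy => h y fun x =>
    (Submodule.mem_orthogonal _ _).1 hy _ ⟨x, rfl⟩
  exact Submodule.dense_iff_topologicalClosure_eq_top.2
    (Submodule.topologicalClosure_eq_top_iff.2 horth)

/-- The operator `(H_γ + m)⁻¹ : L²(ℝ) → Q`, for `m = formShift γ`. -/
def energyResolvent (γ : ℝ) : L2R →L[ℂ] EnergySpace :=
  (Ring.inverse (formOperator γ (formShift γ))).comp (ContinuousLinearMap.adjoint toL2)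

/-- The operator `(H_γ + m)⁻¹` on `L²(ℝ)`, for `m = formShift γ`. -/
def resolvent (γ : ℝ) : L2R →L[ℂ] L2R := toL2.comp (energyResolvent γ)

variable {γ : ℝ}

theorem toL2_energyResolvent (f : L2R) : toL2 (energyResolvent γ f) = resolvent γ f := rfl

theorem bijective_formOperator (hγ : γ ≠ 0) :
    Function.Bijective (formOperator γ (formShift γ)) :=
  Function.bijective_iff_has_inverse.2
    ⟨(Ring.inverse (formOperator γ (formShift γ)) : EnergySpace →L[ℂ] EnergySpace),
    fun u => DFunLike.congr_fun (Ring.inverse_mul_cancel _ (isUnit_formOperator hγ)) u,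
    fun u => DFunLike.congr_fun (Ring.mul_inverse_cancel _ (isUnit_formOperator hγ)) u⟩

theorem inner_formOperator_energyResolvent (hγ : γ ≠ 0) (f : L2R) (v : EnergySpace) :
    inner ℂ (formOperator γ (formShift γ) (energyResolvent γ f)) v = inner ℂ f (toL2 v) := by
  have happly : formOperator γ (formShift γ) (energyResolvent γ f) =
      ContinuousLinearMap.adjoint toL2 f :=
    DFunLike.congr_fun (Ring.mul_inverse_cancel _ (isUnit_formOperator hγ)) _
  rw [happly, ContinuousLinearMap.adjoint_inner_left]

theorem mem_hamiltonian_graph_iff (hγ : γ ≠ 0) (x y : L2R) :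
    (x, y) ∈ (hamiltonian γ).graph ↔ x = resolvent γ (y + (formShift γ : ℂ) • x) := by
  rw [hamiltonian_graph, mem_hamiltonianGraph_iff hγ (formShift γ)]
  constructor
  · rintro ⟨u, rfl, h⟩
    have hu : u = energyResolvent γ (y + (formShift γ : ℂ) • toL2 u) :=
      (bijective_formOperator hγ).1 <| ext_inner_right ℂ fun v => by
        rw [h, inner_formOperator_energyResolvent hγ]
    exact congrArg toL2 hu
  · intro h
    exact ⟨_, h.symm, inner_formOperator_energyResolvent hγ _⟩

theorem inner_energyResolvent (hγ : γ ≠ 0) (f : L2R) (u : EnergySpace) :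
    inner ℂ (energyResolvent γ f) (formOperator γ (formShift γ) u) = inner ℂ f (toL2 u) := by
  rw [← inner_formOperator_symm, inner_formOperator_energyResolvent hγ]

theorem isSelfAdjoint_resolvent (hγ : γ ≠ 0) : IsSelfAdjoint (resolvent γ) :=
  ContinuousLinearMap.isSelfAdjoint_iff_isSymmetric.2 fun f g => by
    calc inner ℂ (resolvent γ f) g
        = inner ℂ (energyResolvent γ f) (formOperator γ (formShift γ) (energyResolvent γ g)) := by
          rw [← toL2_energyResolvent, ← inner_conj_symm (𝕜 := ℂ),
            ← inner_formOperator_energyResolvent hγ]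
          exact inner_conj_symm (energyResolvent γ f) _
      _ = inner ℂ f (resolvent γ g) := inner_energyResolvent hγ f _

theorem denseRange_energyResolvent (hγ : γ ≠ 0) : DenseRange (energyResolvent γ) := by
  refine denseRange_of_forall_inner _ fun u hu => ?_
  obtain ⟨w, rfl⟩ := (bijective_formOperator hγ).2 u
  have hw : toL2 w = 0 := ext_inner_left ℂ fun f => by
    rw [inner_zero_right, ← inner_energyResolvent hγ, hu]
  rw [toL2_injective (hw.trans (map_zero toL2).symm), map_zero]

theorem denseRange_resolvent (hγ : γ ≠ 0) : DenseRange (resolvent γ) := by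
  refine denseRange_of_forall_inner _ fun g hg => ?_
  have hres : resolvent γ g = 0 := ext_inner_left ℂ fun f => by
    rw [inner_zero_right, ← hg f]
    exact ((isSelfAdjoint_resolvent hγ).isSymmetric f g).symm
  have henergy : energyResolvent γ g = 0 := toL2_injective (hres.trans (map_zero toL2).symm)
  exact eq_zero_of_forall_inner_toL2 fun v => by
    rw [← inner_formOperator_energyResolvent hγ, henergy, map_zero, inner_zero_left]

theorem isUnitaryGroupOf_propagator (hγ : γ ≠ 0) :
    IsUnitaryGroupOf (hamiltonian γ) (propagator γ) :=
  Classical.epsilon_spec (p := fun U => IsUnitaryGroupOf (hamiltonian γ) U)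
    ⟨_, isUnitaryGroupOf_phaseGroup (isSelfAdjoint_resolvent hγ) (denseRange_resolvent hγ)
      (formShift γ) (mem_hamiltonian_graph_iff hγ)⟩

theorem resolvent_mem_graph (hγ : γ ≠ 0) (f : L2R) :
    (resolvent γ f, f - (formShift γ : ℂ) • resolvent γ f) ∈ (hamiltonian γ).graph := by
  rw [mem_hamiltonian_graph_iff hγ, sub_add_cancel]

theorem propagator_resolvent (hγ : γ ≠ 0) (t : ℝ) (f : L2R) :
    propagator γ t (resolvent γ f) = resolvent γ (propagator γ t f) := by
  have hgraph := (isUnitaryGroupOf_propagator hγ).apply_mem_graph (resolvent_mem_graph hγ f) t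
  rwa [mem_hamiltonian_graph_iff hγ, map_sub, map_smul, sub_add_cancel] at hgraph

end Resolvent

section EnergyPropagator

/-- The restriction of `e^{-i H_γ t}` to the energy space. -/
def energyPropagator (γ t : ℝ) : EnergySpace →L[ℂ] EnergySpace :=
  LinearMap.extendOfNorm ((energyResolvent γ).comp (propagator γ t) : L2R →ₗ[ℂ] EnergySpace)
    (energyResolvent γ : L2R →ₗ[ℂ] EnergySpace)

variable {γ : ℝ}

/- The group preserves the quadratic form of `H_γ + m`, whose square root is an equivalent norm
on `Q`. -/
theorem norm_energyResolvent_propagator_le (hγ : γ ≠ 0) (t : ℝ) (f : L2R) :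
    ‖energyResolvent γ (propagator γ t f)‖ ≤
      √(2 * ‖formOperator γ (formShift γ)‖) * ‖energyResolvent γ f‖ := by
  set B := formOperator γ (formShift γ)
  have hform : inner ℂ (B (energyResolvent γ (propagator γ t f)))
      (energyResolvent γ (propagator γ t f)) =
        inner ℂ (B (energyResolvent γ f)) (energyResolvent γ f) := by
    rw [inner_formOperator_energyResolvent hγ, inner_formOperator_energyResolvent hγ,
      toL2_energyResolvent, toL2_energyResolvent, ← propagator_resolvent hγ,
      (isUnitaryGroupOf_propagator hγ).inner_apply_apply]
  have hsq : ‖energyResolvent γ (propagator γ t f)‖ ^ 2 / 2 ≤ ‖B‖ * ‖energyResolvent γ f‖ ^ 2 :=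
    calc _ ≤ (inner ℂ (B (energyResolvent γ f)) (energyResolvent γ f)).re :=
          hform ▸ formOperator_coercive hγ _
      _ ≤ ‖B (energyResolvent γ f)‖ * ‖energyResolvent γ f‖ :=
          (Complex.re_le_norm _).trans (norm_inner_le_norm (E := EnergySpace) _ _)
      _ ≤ ‖B‖ * ‖energyResolvent γ f‖ * ‖energyResolvent γ f‖ := by
          gcongr
          exact B.le_opNorm _
      _ = ‖B‖ * ‖energyResolvent γ f‖ ^ 2 := by ring
  refine le_of_sq_le_sq ?_ (by positivity)
  rw [mul_pow, Real.sq_sqrt (by positivity)]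
  linarith

theorem energyPropagator_energyResolvent (hγ : γ ≠ 0) (t : ℝ) (f : L2R) :
    energyPropagator γ t (energyResolvent γ f) = energyResolvent γ (propagator γ t f) :=
  LinearMap.extendOfNorm_eq (denseRange_energyResolvent hγ)
    ⟨_, fun x => norm_energyResolvent_propagator_le hγ t x⟩ f

theorem norm_energyPropagator_le (hγ : γ ≠ 0) (t : ℝ) :
    ‖energyPropagator γ t‖ ≤ √(2 * ‖formOperator γ (formShift γ)‖) :=
  ContinuousLinearMap.opNorm_le_bound _ (Real.sqrt_nonneg _) fun u =>
    LinearMap.norm_extendOfNorm_apply_le (denseRange_energyResolvent hγ) _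
      (fun x => norm_energyResolvent_propagator_le hγ t x) u

theorem toL2_energyPropagator (hγ : γ ≠ 0) (t : ℝ) (u : EnergySpace) :
    toL2 (energyPropagator γ t u) = propagator γ t (toL2 u) := by
  refine congrFun ((denseRange_energyResolvent hγ).equalizer
    (toL2.continuous.comp (energyPropagator γ t).continuous)
    ((propagator γ t).continuous.comp toL2.continuous) (funext fun f => ?_)) u
  simp only [Function.comp_apply, energyPropagator_energyResolvent hγ, toL2_energyResolvent,
    propagator_resolvent hγ]

theorem continuous_energyPropagator (hγ : γ ≠ 0) (u : EnergySpace) :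
    Continuous fun t => energyPropagator γ t u := by
  refine continuous_apply_of_dense (norm_energyPropagator_le hγ)
    (denseRange_energyResolvent hγ) ?_ u
  rintro _ ⟨f, rfl⟩
  simp only [energyPropagator_energyResolvent hγ]
  exact (energyResolvent γ).continuous.comp ((isUnitaryGroupOf_propagator hγ).continuous f)

end EnergyPropagator

/-! ### Mild solutions of semilinear equations -/

namespace IsUnitaryGroupOf

variable {E : Type*} [NormedAddCommGroup E] [InnerProductSpace ℂ E] [CompleteSpace E]
  {A : E →ₗ.[ℂ] E} {U : ℝ → E →L[ℂ] E}

theorem apply_zero (h : IsUnitaryGroupOf A U) (x : E) : U 0 x = x := by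
  rw [h.map_zero, one_apply_eq_self]

theorem apply_neg_apply (h : IsUnitaryGroupOf A U) (t : ℝ) (x : E) : U (-t) (U t x) = x := by
  rw [← h.apply_add, neg_add_cancel, h.apply_zero]

theorem apply_apply_neg (h : IsUnitaryGroupOf A U) (t : ℝ) (x : E) : U t (U (-t) x) = x := by
  rw [← h.apply_add, add_neg_cancel, h.apply_zero]

theorem norm_apply (h : IsUnitaryGroupOf A U) (t : ℝ) (x : E) : ‖U t x‖ = ‖x‖ :=
  ContinuousLinearMap.norm_map_of_mem_unitary (h.mem_unitary t) x

theorem dist_apply (h : IsUnitaryGroupOf A U) (t : ℝ) (x y : E) :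
    dist (U t x) (U t y) = dist x y := by
  rw [dist_eq_norm, ← map_sub, h.norm_apply, dist_eq_norm]

theorem norm_le_one (h : IsUnitaryGroupOf A U) (t : ℝ) : ‖U t‖ ≤ 1 :=
  (U t).opNorm_le_bound zero_le_one fun x => by rw [h.norm_apply, one_mul]

end IsUnitaryGroupOf

theorem continuous_uncurry_of_norm_le {X E F : Type*} [TopologicalSpace X]
    [NormedAddCommGroup E] [NormedSpace ℂ E] [NormedAddCommGroup F] [NormedSpace ℂ F]
    {U : X → E →L[ℂ] F} {C : ℝ} (hC : ∀ t, ‖U t‖ ≤ C) (hU : ∀ x, Continuous fun t => U t x) :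
    Continuous fun p : X × E => U p.1 p.2 :=
  continuous_prod_of_continuous_lipschitzWith' _ C.toNNReal
    (fun t => (U t).lipschitz.weaken (NNReal.le_toNNReal_of_coe_le (hC t))) hU

section TimeInterval

theorem Icc_subset_timeInterval {T : EReal} {t : ℝ} (ht : t ∈ timeInterval T) :
    Icc 0 t ⊆ timeInterval T := fun _ hs =>
  ⟨hs.1, (EReal.coe_le_coe_iff.2 hs.2).trans_lt ht.2⟩

theorem uIcc_subset_timeInterval {T : EReal} {t : ℝ} (ht : t ∈ timeInterval T) :
    uIcc 0 t ⊆ timeInterval T := by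
  rw [uIcc_of_le ht.1]
  exact Icc_subset_timeInterval ht

theorem timeInterval_mono {S T : EReal} (h : S ≤ T) : timeInterval S ⊆ timeInterval T :=
  fun _ ht => ⟨ht.1, ht.2.trans_le h⟩

theorem mem_timeInterval_coe {t T : ℝ} : t ∈ timeInterval T ↔ 0 ≤ t ∧ t < T :=
  and_congr_right' EReal.coe_lt_coe_iff

theorem isOpen_setOf_coe_lt (T : EReal) : IsOpen {t : ℝ | (t : EReal) < T} :=
  isOpen_lt continuous_coe_real_ereal continuous_const

theorem uniqueDiffOn_timeInterval (T : EReal) : UniqueDiffOn ℝ (timeInterval T) :=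
  (uniqueDiffOn_Ici 0).inter (isOpen_setOf_coe_lt T)

theorem timeInterval_mem_nhdsWithin_Ici {T : EReal} {t : ℝ} (ht : t ∈ timeInterval T) :
    timeInterval T ∈ 𝓝[Ici 0] t :=
  inter_mem_nhdsWithin _ ((isOpen_setOf_coe_lt T).mem_nhds ht.2)

variable {E : Type*} [NormedAddCommGroup E] {T : EReal} {f : ℝ → E} {t : ℝ}

theorem intervalIntegrable_of_continuousOn_timeInterval (hf : ContinuousOn f (timeInterval T))
    (ht : t ∈ timeInterval T) : IntervalIntegrable f volume 0 t :=
  (hf.mono (uIcc_subset_timeInterval ht)).intervalIntegrable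

theorem exists_continuousOn_concat {g : ℝ → E} {b τ : ℝ} (hf : ContinuousOn f (timeInterval T))
    (hg : ContinuousOn g (timeInterval τ)) (hb : b ∈ timeInterval T) (hτ : 0 < τ)
    (hfg : f b = g 0) :
    ∃ χ : ℝ → E, ContinuousOn χ (timeInterval (b + τ : ℝ)) ∧ (∀ t ≤ b, χ t = f t) ∧
      ∀ t, 0 ≤ t → χ (t + b) = g t := by
  have hmin : MapsTo (fun t => min t b) (timeInterval (b + τ : ℝ)) (timeInterval T) :=
    fun t ht => Icc_subset_timeInterval hb ⟨le_min ht.1 hb.1, min_le_right _ _⟩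
  have hmax : MapsTo (fun t => max (t - b) 0) (timeInterval (b + τ : ℝ)) (timeInterval τ) :=
    fun t ht => mem_timeInterval_coe.2 ⟨le_max_right _ _,
      max_lt (sub_lt_iff_lt_add'.2 (mem_timeInterval_coe.1 ht).2) hτ⟩
  refine ⟨fun t => f (min t b) + g (max (t - b) 0) - f b,
    ((hf.comp (by fun_prop) hmin).add (hg.comp (by fun_prop) hmax)).sub continuousOn_const,
    fun t ht => ?_, fun t ht => ?_⟩
  · simp only [min_eq_left ht, max_eq_right (sub_nonpos.2 ht), hfg, add_sub_cancel_right]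
  · simp only [min_eq_right (le_add_of_nonneg_left ht), add_sub_cancel_right, max_eq_left ht,
      add_sub_cancel_left]

variable [NormedSpace ℝ E]

theorem hasDerivWithinAt_integral_timeInterval [CompleteSpace E]
    (hf : ContinuousOn f (timeInterval T)) (ht : t ∈ timeInterval T) :
    HasDerivWithinAt (fun u => ∫ s in (0 : ℝ)..u, f s) (f t) (timeInterval T) t := by
  obtain ⟨b, htb, hbT⟩ := EReal.lt_iff_exists_real_btwn.1 ht.2
  have htb' : t < b := EReal.coe_lt_coe_iff.1 htb
  have hsub : Icc 0 b ⊆ timeInterval T := Icc_subset_timeInterval ⟨ht.1.trans htb'.le, hbT⟩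
  have hmem : t ∈ Icc 0 b := ⟨ht.1, htb'.le⟩
  have : Fact (t ∈ Icc 0 b) := ⟨hmem⟩
  refine (intervalIntegral.integral_hasDerivWithinAt_right (s := Icc 0 b)
    (intervalIntegrable_of_continuousOn_timeInterval hf ht)
    ((hf.mono hsub).stronglyMeasurableAtFilter_nhdsWithin measurableSet_Icc t)
    ((hf.mono hsub) t hmem)).mono_of_mem_nhdsWithin ?_
  filter_upwards [self_mem_nhdsWithin, mem_nhdsWithin_of_mem_nhds (Iio_mem_nhds htb')]
    with s hs hsb using ⟨hs.1, hsb.le⟩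

theorem eq_add_integral_of_hasDerivWithinAt_timeInterval [CompleteSpace E] {f' : ℝ → E}
    (hf : ∀ t ∈ timeInterval T, HasDerivWithinAt f (f' t) (timeInterval T) t)
    (hf' : ContinuousOn f' (timeInterval T)) (ht : t ∈ timeInterval T) :
    f t = f 0 + ∫ s in (0 : ℝ)..t, f' s := by
  rw [intervalIntegral.integral_eq_sub_of_hasDeriv_right_of_le ht.1
    (fun s hs => (hf s (Icc_subset_timeInterval ht hs)).continuousWithinAt.mono
      (Icc_subset_timeInterval ht)) (fun s hs => ?_)
    (intervalIntegrable_of_continuousOn_timeInterval hf' ht), add_sub_cancel]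
  have hs' := Icc_subset_timeInterval ht (Ioo_subset_Icc_self hs)
  exact (hf s hs').mono_of_mem_nhdsWithin <| nhdsWithin_mono _
    (fun r hr => hs.1.le.trans (le_of_lt hr)) (timeInterval_mem_nhdsWithin_Ici hs')

theorem hasDerivWithinAt_timeInterval_of_dense {V F : Type*} [NormedAddCommGroup V]
    [NormedSpace ℂ V] [NormedAddCommGroup F] [NormedSpace ℂ F] [CompleteSpace F]
    {J W : ℝ → V →L[ℂ] F} {s : Set V} (hs : Dense s) (hW : ContinuousOn W (timeInterval T))
    (hJ : ∀ x ∈ s, ∀ t ∈ timeInterval T,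
      HasDerivWithinAt (fun t => J t x) (W t x) (timeInterval T) t) (ht : t ∈ timeInterval T) :
    HasDerivWithinAt J (W t) (timeInterval T) t := by
  have heq : ∀ t ∈ timeInterval T, J t = J 0 + ∫ r in (0 : ℝ)..t, W r := fun t ht => by
    refine ContinuousLinearMap.coeFn_injective (Continuous.ext_on hs (J t).continuous
      (J 0 + ∫ r in (0 : ℝ)..t, W r).continuous fun x hx => ?_)
    rw [add_apply, ContinuousLinearMap.intervalIntegral_apply
      (intervalIntegrable_of_continuousOn_timeInterval hW ht)]
    exact eq_add_integral_of_hasDerivWithinAt_timeInterval (hJ x hx)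
      (hW.clm_apply continuousOn_const) ht
  exact ((hasDerivWithinAt_integral_timeInterval hW ht).const_add (J 0)).congr heq (heq t ht)

end TimeInterval

section Ball

variable {E V : Type*} [NormedAddCommGroup E] [NormedSpace ℂ E]
  [NormedAddCommGroup V] [NormedSpace ℂ V] {A : V →L[ℂ] E} {R S : ℝ} {f g : E}

theorem add_mem_image_closedBall (hf : f ∈ A '' Metric.closedBall 0 R)
    (hg : g ∈ A '' Metric.closedBall 0 S) : f + g ∈ A '' Metric.closedBall 0 (R + S) := by
  obtain ⟨u, hu, rfl⟩ := hf
  obtain ⟨v, hv, rfl⟩ := hg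
  rw [mem_closedBall_zero_iff] at hu hv
  exact ⟨u + v, mem_closedBall_zero_iff.2 (norm_add_le_of_le hu hv), map_add _ _ _⟩

theorem image_closedBall_mono (h : R ≤ S) :
    A '' Metric.closedBall 0 R ⊆ A '' Metric.closedBall 0 S :=
  image_mono (Metric.closedBall_subset_closedBall h)

theorem exists_continuousOn_lift (hA : Function.Injective A) {w : ℝ → E} {s : Set ℝ} {M : ℝ}
    (hw : ∀ t, w t ∈ range A)
    (hM : ∀ a ∈ s, ∀ b ∈ s, w b - w a ∈ A '' Metric.closedBall 0 (M * |b - a|)) :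
    ∃ κ : ℝ → V, ContinuousOn κ s ∧ ∀ t, A (κ t) = w t := by
  choose κ hκ using hw
  refine ⟨κ, LipschitzOnWith.continuousOn (K := M.toNNReal)
    (LipschitzOnWith.of_dist_le_mul fun b hb a ha => ?_), hκ⟩
  obtain ⟨z, hz, hAz⟩ := hM a ha b hb
  have hsub : κ b - κ a = z := hA (by rw [map_sub, hκ, hκ, hAz])
  rw [dist_eq_norm, hsub, Real.dist_eq]
  exact (mem_closedBall_zero_iff.1 hz).trans (by gcongr; exact Real.le_coe_toNNReal M)

end Ball

section DualBall

variable {E V : Type*} [NormedAddCommGroup E] [InnerProductSpace ℂ E] [CompleteSpace E]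
  [NormedAddCommGroup V] [InnerProductSpace ℂ V] [CompleteSpace V] {A : V →L[ℂ] E} {R : ℝ}

theorem denseRange_adjoint (hA : Function.Injective A) :
    DenseRange (ContinuousLinearMap.adjoint A) :=
  denseRange_of_forall_inner _ fun u hu => hA <| ext_inner_left ℂ fun g => by
    rw [← ContinuousLinearMap.adjoint_inner_left, hu, map_zero, inner_zero_right]

-- A vector `f` obeying the inequality defines a functional of norm at most `R` on the range of
-- the adjoint, which is dense; its Riesz representative is the required preimage.
theorem mem_image_closedBall_iff (hA : Function.Injective A) (hR : 0 ≤ R) (f : E) :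
    f ∈ A '' Metric.closedBall 0 R ↔
      ∀ g, ‖inner ℂ f g‖ ≤ R * ‖ContinuousLinearMap.adjoint A g‖ := by
  constructor
  · rintro ⟨u, hu, rfl⟩ g
    rw [← ContinuousLinearMap.adjoint_inner_right]
    refine (norm_inner_le_norm _ _).trans ?_
    gcongr
    exact mem_closedBall_zero_iff.1 hu
  · intro h
    have hdense := denseRange_adjoint hA
    have hbound : ∀ g, ‖(innerSL ℂ f : E →ₗ[ℂ] ℂ) g‖ ≤
        R * ‖(ContinuousLinearMap.adjoint A : E →ₗ[ℂ] V) g‖ := h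
    let l := LinearMap.extendOfNorm (innerSL ℂ f : E →ₗ[ℂ] ℂ)
      (ContinuousLinearMap.adjoint A : E →ₗ[ℂ] V)
    have hl : ∀ g, l (ContinuousLinearMap.adjoint A g) = inner ℂ f g :=
      LinearMap.extendOfNorm_eq hdense ⟨R, hbound⟩
    refine ⟨(InnerProductSpace.toDual ℂ V).symm l, ?_, ext_inner_right ℂ fun g => ?_⟩
    · rw [mem_closedBall_zero_iff, LinearIsometryEquiv.norm_map]
      exact LinearMap.opNorm_extendOfNorm_le hdense hR hbound
    · rw [← ContinuousLinearMap.adjoint_inner_right, InnerProductSpace.toDual_symm_apply, hl]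

theorem isClosed_image_closedBall (hA : Function.Injective A) (hR : 0 ≤ R) :
    IsClosed (A '' Metric.closedBall 0 R) := by
  have hball : A '' Metric.closedBall 0 R =
      ⋂ g, {f | ‖inner ℂ f g‖ ≤ R * ‖ContinuousLinearMap.adjoint A g‖} := by
    ext f
    rw [mem_image_closedBall_iff hA hR, mem_iInter]
    rfl
  rw [hball]
  exact isClosed_iInter fun g => isClosed_le (continuous_id.inner continuous_const).norm
    continuous_const

theorem integral_mem_image_closedBall (hA : Function.Injective A) (hR : 0 ≤ R) {F : ℝ → E}
    {a b : ℝ} (hF : IntervalIntegrable F volume a b)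
    (h : ∀ s ∈ uIcc a b, F s ∈ A '' Metric.closedBall 0 R) :
    ∫ s in a..b, F s ∈ A '' Metric.closedBall 0 (R * |b - a|) := by
  rw [mem_image_closedBall_iff hA (by positivity)]
  intro g
  have hcomm : inner ℂ g (∫ s in a..b, F s) = ∫ s in a..b, inner ℂ g (F s) :=
    ((innerSL ℂ g).intervalIntegral_comp_comm hF).symm
  rw [norm_inner_symm, hcomm, mul_right_comm]
  refine intervalIntegral.norm_integral_le_of_norm_le_const fun s hs => ?_
  rw [norm_inner_symm]
  exact (mem_image_closedBall_iff hA hR _).1 (h s (uIoc_subset_uIcc hs)) g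

end DualBall

theorem dist_integral_le_of_dist_le_const {E : Type*} [NormedAddCommGroup E] [NormedSpace ℝ E]
    {f g : ℝ → E} {a b C : ℝ} (hf : IntervalIntegrable f volume a b)
    (hg : IntervalIntegrable g volume a b) (hfg : ∀ s ∈ uIoc a b, dist (f s) (g s) ≤ C) :
    dist (∫ s in a..b, f s) (∫ s in a..b, g s) ≤ C * |b - a| := by
  rw [dist_eq_norm, ← intervalIntegral.integral_sub hf hg]
  exact intervalIntegral.norm_integral_le_of_norm_le_const fun s hs => by
    rw [← dist_eq_norm]
    exact hfg s hs

theorem exists_eq_add_integral {E : Type*} [NormedAddCommGroup E] [NormedSpace ℝ E]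
    [CompleteSpace E] {K : Set E} (hK : IsClosed K) {v : ℝ → E → E} {L : NNReal} {τ : ℝ} {x₀ : E}
    (hx₀ : x₀ ∈ K) (hτ : 0 ≤ τ) (hLτ : L * τ < 1) (hL : ∀ s, LipschitzOnWith L (v s) K)
    (hv : ∀ w : ℝ → E, Continuous w → (∀ t, w t ∈ K) → Continuous fun s => v s (w s))
    (hinv : ∀ w : ℝ → E, Continuous w → (∀ t, w t ∈ K) → ∀ t ∈ Icc 0 τ,
      x₀ + ∫ s in (0 : ℝ)..t, v s (w s) ∈ K) :
    ∃ w : ℝ → E, Continuous w ∧ (∀ t, w t ∈ K) ∧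
      ∀ t ∈ Icc 0 τ, w t = x₀ + ∫ s in (0 : ℝ)..t, v s (w s) := by
  have : CompleteSpace K := hK.completeSpace_coe
  let ext : C(Icc 0 τ, K) → ℝ → E := fun w s => (IccExtend hτ w s : K)
  have hext : ∀ w, Continuous (ext w) := fun w =>
    continuous_subtype_val.comp w.continuous.Icc_extend'
  have hextK : ∀ w s, ext w s ∈ K := fun w s => Subtype.coe_prop _
  have hext_dist : ∀ w w' s, dist (ext w s) (ext w' s) ≤ dist w w' := fun w w' s =>
    ContinuousMap.dist_apply_le_dist (f := w) (g := w') (projIcc 0 τ hτ s)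
  have hint : ∀ w a b, IntervalIntegrable (fun s => v s (ext w s)) volume a b := fun w a b =>
    (hv _ (hext w) (hextK w)).intervalIntegrable a b
  let Φ : C(Icc 0 τ, K) → C(Icc 0 τ, K) := fun w =>
    ⟨fun t => ⟨x₀ + ∫ s in (0 : ℝ)..t, v s (ext w s), hinv _ (hext w) (hextK w) t t.2⟩,
      ((continuous_const.add (intervalIntegral.continuous_primitive (hint w) 0)).comp
        continuous_subtype_val).subtype_mk _⟩
  have hΦ_apply : ∀ w t, (Φ w t : E) = x₀ + ∫ s in (0 : ℝ)..t, v s (ext w s) := fun _ _ => rfl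
  have hΦ : ContractingWith (L * τ.toNNReal) Φ := by
    refine ⟨by rwa [← NNReal.coe_lt_coe, NNReal.coe_mul, Real.coe_toNNReal τ hτ],
      LipschitzWith.of_dist_le_mul fun w w' => ?_⟩
    rw [ContinuousMap.dist_le (by positivity)]
    intro t
    rw [Subtype.dist_eq, hΦ_apply, hΦ_apply, dist_add_left, NNReal.coe_mul, Real.coe_toNNReal τ hτ]
    calc dist (∫ s in (0 : ℝ)..t, v s (ext w s)) (∫ s in (0 : ℝ)..t, v s (ext w' s))
        ≤ L * dist w w' * |(t : ℝ) - 0| :=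
          dist_integral_le_of_dist_le_const (hint w _ _) (hint w' _ _) fun s _ =>
            ((hL s).dist_le_mul _ (hextK w s) _ (hextK w' s)).trans <|
              mul_le_mul_of_nonneg_left (hext_dist w w' s) L.coe_nonneg
      _ ≤ L * dist w w' * τ := by
          rw [sub_zero, abs_of_nonneg t.2.1]
          gcongr
          exact t.2.2
      _ = L * τ * dist w w' := by ring
  have : Nonempty C(Icc 0 τ, K) := ⟨ContinuousMap.const _ ⟨x₀, hx₀⟩⟩
  refine ⟨ext (hΦ.fixedPoint Φ), hext _, hextK _, fun t ht => ?_⟩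
  have hfix := hΦ_apply (hΦ.fixedPoint Φ) ⟨t, ht⟩
  rw [hΦ.fixedPoint_isFixedPt.eq] at hfix
  simpa only [ext, IccExtend_of_mem hτ _ ht] using hfix

/-- An abstract semilinear Schrödinger equation: a unitary group `U` on `E` that restricts to a
bounded strongly continuous group `UV` on a space `V` embedded in `E`, and a nonlinearity `N` on
`E` that maps bounded sets of `V` to bounded sets of `V` and is there Lipschitz for the norm of
`E`. As the nonlinearity need not be Lipschitz for the norm of `V`, the fixed point argument takes
place in `E`, on balls of `V`. -/
structure SemilinearFlow (E V : Type*) [NormedAddCommGroup E] [InnerProductSpace ℂ E]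
    [CompleteSpace E] [NormedAddCommGroup V] [InnerProductSpace ℂ V] where
  generator : E →ₗ.[ℂ] E
  U : ℝ → E →L[ℂ] E
  isUnitaryGroupOf : IsUnitaryGroupOf generator U
  embed : V →L[ℂ] E
  embed_injective : Function.Injective embed
  UV : ℝ → V →L[ℂ] V
  embed_UV : ∀ t v, embed (UV t v) = U t (embed v)
  continuous_UV : ∀ v, Continuous fun t => UV t v
  bound : ℝ
  norm_UV_le : ∀ t, ‖UV t‖ ≤ bound
  N : E → E
  exists_mapsTo : ∀ R : ℝ, ∃ M : ℝ, MapsTo N (embed '' Metric.closedBall 0 R)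
    (embed '' Metric.closedBall 0 M)
  exists_lipschitz : ∀ R : ℝ, ∃ L, LipschitzOnWith L N (embed '' Metric.closedBall 0 R)

namespace SemilinearFlow

variable {E V : Type*} [NormedAddCommGroup E] [InnerProductSpace ℂ E] [CompleteSpace E]
  [NormedAddCommGroup V] [InnerProductSpace ℂ V] (D : SemilinearFlow E V)

/-- `ψ` is a mild solution on `[0, T)`, continuous with values in `V`, of the equation with
Duhamel term `∫₀ᵗ U (t - s) (N (ψ s)) ds`. The equation is stated in the interaction picture, that
is, after an application of `U (-t)`. -/
structure IsMild (v₀ : V) (T : EReal) (ψ : ℝ → V) : Prop where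
  continuousOn : ContinuousOn ψ (timeInterval T)
  interaction : ∀ t ∈ timeInterval T, D.U (-t) (D.embed (ψ t)) =
    D.embed v₀ + ∫ s in (0 : ℝ)..t, D.U (-s) (D.N (D.embed (ψ s)))

/-- The nonlinearity in the interaction picture. -/
def interactionN (t : ℝ) (x : E) : E := D.U (-t) (D.N (D.U t x))

theorem bound_nonneg : 0 ≤ D.bound := (norm_nonneg _).trans (D.norm_UV_le 0)

theorem continuous_uncurry_U : Continuous fun p : ℝ × E => D.U p.1 p.2 :=
  continuous_uncurry_of_norm_le D.isUnitaryGroupOf.norm_le_one D.isUnitaryGroupOf.continuous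

theorem continuous_uncurry_UV : Continuous fun p : ℝ × V => D.UV p.1 p.2 :=
  continuous_uncurry_of_norm_le D.norm_UV_le D.continuous_UV

theorem continuous_N_embed : Continuous fun v => D.N (D.embed v) := by
  refine continuous_iff_continuousAt.2 fun v => ?_
  obtain ⟨L, hL⟩ := D.exists_lipschitz (‖v‖ + 1)
  have hball : ContinuousOn (fun v => D.N (D.embed v)) (Metric.closedBall 0 (‖v‖ + 1)) :=
    hL.continuousOn.comp D.embed.continuous.continuousOn (mapsTo_image _ _)
  exact hball.continuousAt (Metric.closedBall_mem_nhds_of_mem (by simp))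

theorem U_mem_image_closedBall {R : ℝ} (t : ℝ) {x : E}
    (hx : x ∈ D.embed '' Metric.closedBall 0 R) :
    D.U t x ∈ D.embed '' Metric.closedBall 0 (D.bound * R) := by
  obtain ⟨u, hu, rfl⟩ := hx
  refine ⟨D.UV t u, mem_closedBall_zero_iff.2 ?_, D.embed_UV t u⟩
  exact (D.UV t).le_of_opNorm_le_of_le (D.norm_UV_le t) (mem_closedBall_zero_iff.1 hu)

variable {D}

theorem lipschitzOnWith_interactionN {L : NNReal} {s : Set E} (hL : LipschitzOnWith L D.N s)
    (t : ℝ) : LipschitzOnWith L (D.interactionN t) (D.U t ⁻¹' s) :=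
  LipschitzOnWith.of_dist_le_mul fun x hx y hy => by
    rw [interactionN, interactionN, D.isUnitaryGroupOf.dist_apply,
      ← D.isUnitaryGroupOf.dist_apply t x y]
    exact hL.dist_le_mul _ hx _ hy

theorem interactionN_U_neg (t : ℝ) (x : E) : D.interactionN t (D.U (-t) x) = D.U (-t) (D.N x) := by
  rw [interactionN, D.isUnitaryGroupOf.apply_apply_neg]

theorem continuousOn_U_sub_N {ψ : ℝ → V} {s : Set ℝ} (hψ : ContinuousOn ψ s) (t : ℝ) :
    ContinuousOn (fun s => D.U (t - s) (D.N (D.embed (ψ s)))) s :=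
  D.continuous_uncurry_U.comp_continuousOn
    ((continuousOn_const.sub continuousOn_id).prodMk (D.continuous_N_embed.comp_continuousOn hψ))

theorem continuousOn_U_neg_N {ψ : ℝ → V} {s : Set ℝ} (hψ : ContinuousOn ψ s) :
    ContinuousOn (fun s => D.U (-s) (D.N (D.embed (ψ s)))) s := by
  simpa only [zero_sub] using D.continuousOn_U_sub_N hψ 0

theorem integral_U_sub {F : ℝ → E} (t : ℝ) {a b : ℝ}
    (hF : IntervalIntegrable (fun s => D.U (-s) (F s)) volume a b) :
    ∫ s in a..b, D.U (t - s) (F s) = D.U t (∫ s in a..b, D.U (-s) (F s)) := by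
  rw [← (D.U t).intervalIntegral_comp_comm hF]
  simp only [← D.isUnitaryGroupOf.apply_add, sub_eq_add_neg]

theorem isMild_iff_duhamel {v₀ : V} {T : EReal} {ψ : ℝ → V}
    (hψ : ContinuousOn ψ (timeInterval T)) :
    D.IsMild v₀ T ψ ↔ ∀ t ∈ timeInterval T, D.embed (ψ t) =
      D.U t (D.embed v₀) + ∫ s in (0 : ℝ)..t, D.U (t - s) (D.N (D.embed (ψ s))) := by
  have hiff : ∀ t ∈ timeInterval T, (D.embed (ψ t) = D.U t (D.embed v₀) +
        ∫ s in (0 : ℝ)..t, D.U (t - s) (D.N (D.embed (ψ s)))) ↔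
      D.U (-t) (D.embed (ψ t)) =
        D.embed v₀ + ∫ s in (0 : ℝ)..t, D.U (-s) (D.N (D.embed (ψ s))) := fun t ht => by
    rw [integral_U_sub t (intervalIntegrable_of_continuousOn_timeInterval
      (D.continuousOn_U_neg_N hψ) ht), ← map_add]
    constructor <;> intro heq
    · rw [heq, D.isUnitaryGroupOf.apply_neg_apply]
    · rw [← heq, D.isUnitaryGroupOf.apply_apply_neg]
  exact ⟨fun h t ht => (hiff t ht).2 (h.interaction t ht),
    fun h => ⟨hψ, fun t ht => (hiff t ht).1 (h t ht)⟩⟩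

namespace IsMild

variable {v₀ : V} {T : EReal} {ψ : ℝ → V}

theorem duhamel (h : D.IsMild v₀ T ψ) {t : ℝ} (ht : t ∈ timeInterval T) :
    D.embed (ψ t) = D.U t (D.embed v₀) +
      ∫ s in (0 : ℝ)..t, D.U (t - s) (D.N (D.embed (ψ s))) :=
  (isMild_iff_duhamel h.continuousOn).1 h t ht

theorem mono (h : D.IsMild v₀ T ψ) {S : EReal} (hS : S ≤ T) : D.IsMild v₀ S ψ :=
  ⟨h.continuousOn.mono (timeInterval_mono hS),
    fun t ht => h.interaction t (timeInterval_mono hS ht)⟩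

theorem apply_zero (h : D.IsMild v₀ T ψ) (hT : 0 < T) : ψ 0 = v₀ := by
  have hzero := h.interaction 0 ⟨le_rfl, hT⟩
  rw [neg_zero, D.isUnitaryGroupOf.apply_zero, intervalIntegral.integral_same, add_zero] at hzero
  exact D.embed_injective hzero

theorem hasDerivWithinAt_interaction (h : D.IsMild v₀ T ψ) {t : ℝ} (ht : t ∈ timeInterval T) :
    HasDerivWithinAt (fun t => D.U (-t) (D.embed (ψ t)))
      (D.interactionN t (D.U (-t) (D.embed (ψ t)))) (timeInterval T) t := by
  rw [interactionN_U_neg]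
  exact ((hasDerivWithinAt_integral_timeInterval (D.continuousOn_U_neg_N h.continuousOn)
    ht).const_add _).congr h.interaction (h.interaction t ht)

theorem eqOn {φ : ℝ → V} (h : D.IsMild v₀ T ψ) (h' : D.IsMild v₀ T φ) :
    EqOn ψ φ (timeInterval T) := by
  intro t ht
  have hsub := Icc_subset_timeInterval ht
  obtain ⟨R, hR⟩ := isCompact_Icc.exists_bound_of_continuousOn
    ((h.continuousOn.prodMk h'.continuousOn).mono hsub)
  obtain ⟨L, hL⟩ := D.exists_lipschitz R
  have hIci : ∀ s ∈ Ico 0 t, timeInterval T ∈ 𝓝[Ici s] s := fun s hs =>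
    nhdsWithin_mono s (Ici_subset_Ici.2 hs.1)
      (timeInterval_mem_nhdsWithin_Ici (hsub (Ico_subset_Icc_self hs)))
  have hball : ∀ u : V, ∀ s, ‖u‖ ≤ R →
      D.U (-s) (D.embed u) ∈ D.U s ⁻¹' (D.embed '' Metric.closedBall 0 R) := fun u s hu => by
    rw [mem_preimage, D.isUnitaryGroupOf.apply_apply_neg]
    exact mem_image_of_mem _ (mem_closedBall_zero_iff.2 hu)
  have hunique : EqOn (fun s => D.U (-s) (D.embed (ψ s))) (fun s => D.U (-s) (D.embed (φ s)))
      (Icc 0 t) := ODE_solution_unique_of_mem_Icc_right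
    (fun s _ => lipschitzOnWith_interactionN hL s)
    (fun s hs => (h.hasDerivWithinAt_interaction (hsub hs)).continuousWithinAt.mono hsub)
    (fun s hs => (h.hasDerivWithinAt_interaction
      (hsub (Ico_subset_Icc_self hs))).mono_of_mem_nhdsWithin (hIci s hs))
    (fun s hs => hball _ s ((le_max_left _ _).trans (hR s (Ico_subset_Icc_self hs))))
    (fun s hs => (h'.hasDerivWithinAt_interaction (hsub hs)).continuousWithinAt.mono hsub)
    (fun s hs => (h'.hasDerivWithinAt_interaction
      (hsub (Ico_subset_Icc_self hs))).mono_of_mem_nhdsWithin (hIci s hs))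
    (fun s hs => hball _ s ((le_max_right _ _).trans (hR s (Ico_subset_Icc_self hs))))
    (by
      have hT : 0 < T := (EReal.coe_nonneg.2 ht.1).trans_lt ht.2
      rw [h.apply_zero hT, h'.apply_zero hT])
  have ht' := congrArg (D.U t) (hunique (right_mem_Icc.2 ht.1))
  simp only [D.isUnitaryGroupOf.apply_apply_neg] at ht'
  exact D.embed_injective ht'

theorem interaction_add (h : D.IsMild v₀ T ψ) {t : ℝ} (ht : t ∈ timeInterval T) (b : ℝ) :
    D.U (-(t + b)) (D.embed (ψ t)) =
      D.U (-b) (D.embed v₀) + ∫ s in b..t + b, D.U (-s) (D.N (D.embed (ψ (s - b)))) := by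
  have hshift := intervalIntegral.integral_comp_sub_right (a := b) (b := t + b)
    (fun s => D.U (-b) (D.U (-s) (D.N (D.embed (ψ s))))) b
  simp only [← D.isUnitaryGroupOf.apply_add, ← neg_add, add_sub_cancel, sub_self,
    add_sub_cancel_right] at hshift
  rw [hshift, add_comm t b, neg_add, D.isUnitaryGroupOf.apply_add, h.interaction t ht, map_add,
    ← (D.U (-b)).intervalIntegral_comp_comm (intervalIntegrable_of_continuousOn_timeInterval
      (D.continuousOn_U_neg_N h.continuousOn) ht)]
  simp only [← D.isUnitaryGroupOf.apply_add, neg_add]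

theorem apply_eq {S : EReal} {φ : ℝ → V} (h : D.IsMild v₀ T ψ) (h' : D.IsMild v₀ S φ) {t : ℝ}
    (hT : t ∈ timeInterval T) (hS : t ∈ timeInterval S) : ψ t = φ t :=
  (h.mono (min_le_left T S)).eqOn (h'.mono (min_le_right T S)) ⟨hT.1, lt_min hT.2 hS.2⟩

end IsMild

theorem IsMild.concat {v₀ : V} {T : EReal} {ψ φ : ℝ → V} {b τ : ℝ} (h : D.IsMild v₀ T ψ)
    (hb : b ∈ timeInterval T) (hτ : 0 < τ) (h' : D.IsMild (ψ b) τ φ) :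
    ∃ χ, D.IsMild v₀ (b + τ : ℝ) χ := by
  obtain ⟨χ, hχc, hleft, hright⟩ := exists_continuousOn_concat h.continuousOn h'.continuousOn hb hτ
    (h'.apply_zero (EReal.coe_pos.2 hτ)).symm
  have hintegrable : ∀ t ∈ timeInterval (b + τ : ℝ),
      IntervalIntegrable (fun s => D.U (-s) (D.N (D.embed (χ s)))) volume 0 t := fun t ht =>
    intervalIntegrable_of_continuousOn_timeInterval (D.continuousOn_U_neg_N hχc) ht
  have hfirst : ∀ t ∈ Icc 0 b, D.U (-t) (D.embed (χ t)) =
      D.embed v₀ + ∫ s in (0 : ℝ)..t, D.U (-s) (D.N (D.embed (χ s))) := fun t ht => by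
    rw [hleft t ht.2, h.interaction t (Icc_subset_timeInterval hb ht)]
    congr 1
    refine intervalIntegral.integral_congr fun s hs => ?_
    rw [uIcc_of_le ht.1] at hs
    simp only [hleft s (hs.2.trans ht.2)]
  refine ⟨χ, hχc, fun t ht => ?_⟩
  rcases le_or_gt t b with htb | htb
  · exact hfirst t ⟨ht.1, htb⟩
  · obtain ⟨r, hr, rfl⟩ : ∃ r, 0 ≤ r ∧ t = r + b := ⟨t - b, (sub_pos.2 htb).le, by ring⟩
    have hrτ : r ∈ timeInterval τ :=
      mem_timeInterval_coe.2 ⟨hr, by linarith [(mem_timeInterval_coe.1 ht).2]⟩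
    have hsecond : ∫ s in b..r + b, D.U (-s) (D.N (D.embed (χ s))) =
        ∫ s in b..r + b, D.U (-s) (D.N (D.embed (φ (s - b)))) :=
      intervalIntegral.integral_congr fun s hs => by
        rw [uIcc_of_le htb.le] at hs
        simp only [← hright (s - b) (sub_nonneg.2 hs.1), sub_add_cancel]
    have hbτ : b ∈ timeInterval (b + τ : ℝ) := Icc_subset_timeInterval ht ⟨hb.1, htb.le⟩
    rw [← intervalIntegral.integral_add_adjacent_intervals (hintegrable b hbτ)
      ((hintegrable b hbτ).symm.trans (hintegrable _ ht)), hsecond, hright r hr,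
      h'.interaction_add hrτ b, ← hleft b le_rfl, hfirst b ⟨hb.1, le_rfl⟩, add_assoc]

variable (D)

theorem exists_interactionN_bounds (R : ℝ) : ∃ M : ℝ, 0 ≤ M ∧ ∃ L : NNReal, ∀ t,
    MapsTo (D.interactionN t) (D.embed '' Metric.closedBall 0 R)
      (D.embed '' Metric.closedBall 0 M) ∧
    LipschitzOnWith L (D.interactionN t) (D.embed '' Metric.closedBall 0 R) := by
  obtain ⟨M, hM⟩ := D.exists_mapsTo (D.bound * R)
  obtain ⟨L, hL⟩ := D.exists_lipschitz (D.bound * R)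
  refine ⟨D.bound * max M 0, mul_nonneg D.bound_nonneg (le_max_right _ _), L, fun t => ⟨?_, ?_⟩⟩
  · exact fun x hx => D.U_mem_image_closedBall (-t)
      (image_closedBall_mono (le_max_left _ _) (hM (D.U_mem_image_closedBall t hx)))
  · exact (lipschitzOnWith_interactionN hL t).mono fun x hx => D.U_mem_image_closedBall t hx

theorem continuous_interactionN_comp {R : ℝ} {w : ℝ → E} (hw : Continuous w)
    (hwR : ∀ t, w t ∈ D.embed '' Metric.closedBall 0 R) :
    Continuous fun t => D.interactionN t (w t) := by
  obtain ⟨L, hL⟩ := D.exists_lipschitz (D.bound * R)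
  exact D.continuous_uncurry_U.comp (continuous_neg.prodMk (hL.continuousOn.comp_continuous
    (D.continuous_uncurry_U.comp (continuous_id.prodMk hw))
    fun t => D.U_mem_image_closedBall t (hwR t)))

-- The contraction takes place for the norm of `E`, in the ball of radius `R + 1` of `V`.
theorem exists_isMild [CompleteSpace V] (R : ℝ) :
    ∃ τ : ℝ, 0 < τ ∧ ∀ v₀, ‖v₀‖ ≤ R → ∃ ψ, D.IsMild v₀ τ ψ := by
  obtain ⟨M, hM₀, L, hML⟩ := D.exists_interactionN_bounds (R + 1)
  have hden : 0 < M + L + 1 := by positivity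
  refine ⟨1 / (M + L + 1), by positivity, fun v₀ hv₀ => ?_⟩
  set τ := 1 / (M + L + 1) with hτ
  have hτ₀ : 0 ≤ τ := by positivity
  have hMτ : M * τ ≤ 1 := by
    rw [hτ, mul_one_div, div_le_one hden]
    linarith [L.coe_nonneg]
  have hLτ : L * τ < 1 := by
    rw [hτ, mul_one_div, div_lt_one hden]
    linarith
  have hR : 0 ≤ R + 1 := by linarith [norm_nonneg v₀]
  have hv₀R : D.embed v₀ ∈ D.embed '' Metric.closedBall 0 R :=
    mem_image_of_mem _ (mem_closedBall_zero_iff.2 hv₀)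
  have hint : ∀ w : ℝ → E, Continuous w →
      (∀ t, w t ∈ D.embed '' Metric.closedBall 0 (R + 1)) → ∀ a b,
      ∫ s in a..b, D.interactionN s (w s) ∈ D.embed '' Metric.closedBall 0 (M * |b - a|) :=
    fun w hw hwR a b => integral_mem_image_closedBall D.embed_injective hM₀
      ((D.continuous_interactionN_comp hw hwR).intervalIntegrable a b)
      fun s _ => (hML s).1 (hwR s)
  obtain ⟨w, hw, hwR, hwint⟩ := exists_eq_add_integral
    (isClosed_image_closedBall D.embed_injective hR)
    (image_closedBall_mono (by linarith) hv₀R) hτ₀ hLτ (fun s => (hML s).2)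
    (fun w hw hwR => D.continuous_interactionN_comp hw hwR) fun w hw hwR t ht => by
      refine image_closedBall_mono ?_ (add_mem_image_closedBall hv₀R (hint w hw hwR 0 t))
      rw [sub_zero, abs_of_nonneg ht.1]
      gcongr
      exact (mul_le_mul_of_nonneg_left ht.2 hM₀).trans hMτ
  have hint' := (D.continuous_interactionN_comp hw hwR).intervalIntegrable (μ := volume)
  obtain ⟨κ, hκc, hκ⟩ := exists_continuousOn_lift D.embed_injective (s := Icc 0 τ)
    (fun t => image_subset_range _ _ (hwR t)) fun a ha b hb => by
      rw [hwint a ha, hwint b hb, add_sub_add_left_eq_sub,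
        intervalIntegral.integral_interval_sub_left (hint' _ _) (hint' _ _)]
      exact hint w hw hwR a b
  have hsub : timeInterval τ ⊆ Icc 0 τ := fun t ht => ⟨ht.1, (mem_timeInterval_coe.1 ht).2.le⟩
  refine ⟨fun t => D.UV t (κ t), D.continuous_uncurry_UV.comp_continuousOn
    (continuousOn_id.prodMk (hκc.mono hsub)), fun t ht => ?_⟩
  simp only [D.embed_UV, hκ, D.isUnitaryGroupOf.apply_neg_apply]
  exact hwint t (hsub ht)

variable {D} {v₀ : V} {T : EReal} {ψ : ℝ → V}

variable (D v₀) in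
/-- The supremum of the times up to which a mild solution with initial value `v₀` exists. -/
def maximalTime : EReal := sSup {T | ∃ ψ, D.IsMild v₀ T ψ}

theorem IsMild.le_maximalTime (h : D.IsMild v₀ T ψ) : T ≤ D.maximalTime v₀ := le_sSup ⟨ψ, h⟩

theorem isMild_of_forall_exists (h : ∀ t ∈ timeInterval T, ∃ S φ, D.IsMild v₀ S φ ∧
    t ∈ timeInterval S ∧ EqOn ψ φ (timeInterval S)) : D.IsMild v₀ T ψ := by
  refine ⟨fun t ht => ?_, fun t ht => ?_⟩ <;> obtain ⟨S, φ, hφ, htS, hψφ⟩ := h t ht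
  · exact ((hφ.continuousOn.congr hψφ) t htS).mono_of_mem_nhdsWithin
      (nhdsWithin_mono t (fun _ hs => hs.1) (timeInterval_mem_nhdsWithin_Ici htS))
  · rw [hψφ htS, hφ.interaction t htS]
    congr 1
    refine intervalIntegral.integral_congr fun s hs => ?_
    simp only [hψφ (uIcc_subset_timeInterval htS hs)]

variable (D) in
theorem exists_isMild_maximalTime (v₀ : V) : ∃ ψ, D.IsMild v₀ (D.maximalTime v₀) ψ := by
  have hex : ∀ t ∈ timeInterval (D.maximalTime v₀), ∃ S φ, D.IsMild v₀ S φ ∧ t ∈ timeInterval S :=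
    fun t ht => by
      obtain ⟨S, ⟨φ, hφ⟩, hS⟩ := lt_sSup_iff.1 ht.2
      exact ⟨S, φ, hφ, ht.1, hS⟩
  choose! S φ hφ hmem using hex
  refine ⟨fun t => φ t t, isMild_of_forall_exists fun t ht => ⟨S t, φ t, hφ t ht, hmem t ht,
    fun s hs => ?_⟩⟩
  have hs' := timeInterval_mono (hφ t ht).le_maximalTime hs
  exact (hφ s hs').apply_eq (hφ t ht) (hmem s hs') hs

variable (D) in
theorem maximalTime_pos [CompleteSpace V] (v₀ : V) : 0 < D.maximalTime v₀ := by
  obtain ⟨τ, hτ, hex⟩ := D.exists_isMild ‖v₀‖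
  obtain ⟨φ, hφ⟩ := hex v₀ le_rfl
  exact (EReal.coe_pos.2 hτ).trans_le hφ.le_maximalTime

-- A solution of norm at most `R` at time `t` can be continued for a time that depends only on `R`.
theorem IsMild.tendsto_norm_atTop [CompleteSpace V] {b : ℝ} (h : D.IsMild v₀ b ψ)
    (hb : D.maximalTime v₀ = b) : Tendsto (fun t => ‖ψ t‖) (𝓝[<] b) atTop := by
  refine tendsto_atTop.2 fun R => ?_
  obtain ⟨τ, hτ, hex⟩ := D.exists_isMild R
  have hb₀ : 0 < b := EReal.coe_pos.1 (hb ▸ D.maximalTime_pos v₀)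
  filter_upwards [Ioo_mem_nhdsLT (max_lt hb₀ (sub_lt_self b hτ))] with t ht
  obtain ⟨ht₀, htτ⟩ := max_lt_iff.1 ht.1
  by_contra! hR
  obtain ⟨φ, hφ⟩ := hex (ψ t) hR.le
  obtain ⟨χ, hχ⟩ := h.concat (mem_timeInterval_coe.2 ⟨ht₀.le, ht.2⟩) hτ hφ
  have hle := hχ.le_maximalTime
  rw [hb, EReal.coe_le_coe_iff] at hle
  linarith

theorem IsMild.hasDerivWithinAt_inner (h : D.IsMild v₀ T ψ) {x y : E}
    (hxy : (x, y) ∈ D.generator.graph) {t : ℝ} (ht : t ∈ timeInterval T) :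
    HasDerivWithinAt (fun t => inner ℂ (D.embed (ψ t)) x)
      (inner ℂ (D.N (D.embed (ψ t))) x + Complex.I * inner ℂ (D.embed (ψ t)) y)
      (timeInterval T) t := by
  have hU := D.isUnitaryGroupOf
  have horbit : HasDerivAt (fun s => D.U (-s) x) (Complex.I • D.U (-t) y) t := by
    simpa only [neg_one_smul, neg_neg, Function.comp_def] using
      (hU.hasDerivAt hxy (-t)).scomp t (hasDerivAt_neg t)
  have hinner := (h.hasDerivWithinAt_interaction ht).inner ℂ horbit.hasDerivWithinAt
  rw [interactionN_U_neg, inner_smul_right] at hinner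
  simpa only [hU.inner_apply_apply, add_comm] using hinner

theorem IsMild.contDiffOn (h : D.IsMild v₀ T ψ) {S : V →L[ℂ] V}
    (hS : ∀ u v y, (D.embed v, y) ∈ D.generator.graph → inner ℂ (S u) v = inner ℂ (D.embed u) y)
    (hdense : Dense {v | ∃ y, (D.embed v, y) ∈ D.generator.graph}) :
    ContDiffOn ℝ 1 (fun t => (innerSL ℂ (D.embed (ψ t))).comp D.embed) (timeInterval T) := by
  set W : ℝ → StrongDual ℂ V := fun t => (innerSL ℂ (D.N (D.embed (ψ t)))).comp D.embed +
    Complex.I • innerSL ℂ (S (ψ t))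
  have hN : ContinuousOn (fun t => innerSL ℂ (D.N (D.embed (ψ t)))) (timeInterval T) :=
    (innerSL ℂ).continuous.comp_continuousOn
      (D.continuous_N_embed.comp_continuousOn h.continuousOn)
  have hSψ : ContinuousOn (fun t => innerSL ℂ (S (ψ t))) (timeInterval T) :=
    (innerSL ℂ).continuous.comp_continuousOn (S.continuous.comp_continuousOn h.continuousOn)
  have hWc : ContinuousOn W (timeInterval T) :=
    (hN.clm_comp continuousOn_const).add (hSψ.const_smul Complex.I)
  have hderiv : ∀ t ∈ timeInterval T,
      HasDerivWithinAt (fun t => (innerSL ℂ (D.embed (ψ t))).comp D.embed) (W t)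
        (timeInterval T) t := fun t ht => by
    refine hasDerivWithinAt_timeInterval_of_dense hdense hWc (fun v hv t ht => ?_) ht
    obtain ⟨y, hy⟩ := hv
    have hWv : W t v =
        inner ℂ (D.N (D.embed (ψ t))) (D.embed v) + Complex.I * inner ℂ (D.embed (ψ t)) y := by
      rw [← hS _ _ _ hy]
      rfl
    rw [hWv]
    exact h.hasDerivWithinAt_inner hy ht
  have hunique := uniqueDiffOn_timeInterval T
  rw [show (1 : WithTop ℕ∞) = 0 + 1 from (zero_add 1).symm,
    contDiffOn_succ_iff_derivWithin hunique]
  refine ⟨fun t ht => (hderiv t ht).differentiableWithinAt, fun h0 => absurd h0 (by simp),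
    contDiffOn_zero.2 ?_⟩
  exact hWc.congr fun t ht => (hderiv t ht).derivWithin (hunique t ht)

end SemilinearFlow

/-! ### The power nonlinearity -/

section PowerNonlinearity

/-- The function `z ↦ |z|^p z` on the complex numbers. The pointwise nonlinearity `powFun μ f` is
its composition with `f`, for the exponent `p = 2 μ`. -/
def powC (p : ℝ) (z : ℂ) : ℂ := ((‖z‖ ^ p : ℝ) : ℂ) * z

theorem rpow_sub_rpow_mul_le {p a b : ℝ} (hp : 0 ≤ p) (hb : 0 ≤ b) (hab : b ≤ a) :
    (a ^ p - b ^ p) * b ≤ p * a ^ p * (a - b) := by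
  rcases hb.eq_or_lt with rfl | hb
  · have := Real.rpow_nonneg hab p
    rw [mul_zero, sub_zero]
    positivity
  have ha : 0 < a := hb.trans_le hab
  have hratio : 1 - (b / a) ^ p ≤ p * (a / b - 1) := by
    have hlog_pow := Real.log_le_sub_one_of_pos (Real.rpow_pos_of_pos (div_pos hb ha) p)
    have hlog := Real.log_le_sub_one_of_pos (div_pos ha hb)
    rw [Real.log_rpow (div_pos hb ha), ← inv_div, Real.log_inv, inv_div] at hlog_pow
    nlinarith
  have hpow : b ^ p = a ^ p * (b / a) ^ p := by
    rw [← Real.mul_rpow ha.le (div_pos hb ha).le, mul_div_cancel₀ _ ha.ne']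
  calc (a ^ p - b ^ p) * b = a ^ p * (1 - (b / a) ^ p) * b := by rw [hpow]; ring
    _ ≤ a ^ p * (p * (a / b - 1)) * b := by
        have := Real.rpow_nonneg ha.le p
        gcongr
    _ = p * a ^ p * (a - b) := by field_simp

variable {p : ℝ}

theorem norm_powC_sub_le (hp : 0 ≤ p) {r : ℝ} {z w : ℂ} (hz : ‖z‖ ≤ r) (hw : ‖w‖ ≤ r) :
    ‖powC p z - powC p w‖ ≤ (p + 1) * r ^ p * ‖z - w‖ := by
  wlog hwz : ‖w‖ ≤ ‖z‖ generalizing z w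
  · rw [norm_sub_rev, norm_sub_rev z]
    exact this hw hz (not_le.1 hwz).le
  have hnonneg : 0 ≤ ‖z‖ ^ p := Real.rpow_nonneg (norm_nonneg _) _
  have hdiff : 0 ≤ ‖z‖ ^ p - ‖w‖ ^ p := sub_nonneg.2 (Real.rpow_le_rpow (norm_nonneg _) hwz hp)
  have hsplit : powC p z - powC p w = ((‖z‖ ^ p : ℝ) : ℂ) * (z - w) +
      ((‖z‖ ^ p - ‖w‖ ^ p : ℝ) : ℂ) * w := by
    simp only [powC]
    push_cast
    ring
  calc ‖powC p z - powC p w‖ ≤ ‖z‖ ^ p * ‖z - w‖ + (‖z‖ ^ p - ‖w‖ ^ p) * ‖w‖ := by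
        rw [hsplit]
        refine (norm_add_le _ _).trans_eq ?_
        rw [norm_mul, norm_mul, Complex.norm_of_nonneg hnonneg, Complex.norm_of_nonneg hdiff]
    _ ≤ ‖z‖ ^ p * ‖z - w‖ + p * ‖z‖ ^ p * (‖z‖ - ‖w‖) := by
        gcongr _ + ?_
        exact rpow_sub_rpow_mul_le hp (norm_nonneg w) hwz
    _ ≤ ‖z‖ ^ p * ‖z - w‖ + p * ‖z‖ ^ p * ‖z - w‖ := by
        gcongr
        exact norm_sub_norm_le z w
    _ = (p + 1) * ‖z‖ ^ p * ‖z - w‖ := by ring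
    _ ≤ (p + 1) * r ^ p * ‖z - w‖ := by gcongr

theorem norm_powC_le (hp : 0 ≤ p) {r : ℝ} {z : ℂ} (hz : ‖z‖ ≤ r) : ‖powC p z‖ ≤ r ^ p * ‖z‖ := by
  rw [powC, norm_mul, Complex.norm_of_nonneg (Real.rpow_nonneg (norm_nonneg _) _)]
  gcongr

theorem continuous_powC (hp : 0 ≤ p) : Continuous (powC p) :=
  (Complex.continuous_ofReal.comp (continuous_norm.rpow_const fun _ => Or.inr hp)).mul
    continuous_id

variable {μ : ℝ}

theorem memLp_powFun (hμ : 0 ≤ μ) (u : EnergySpace) :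
    MemLp (powFun μ (toL2 u)) 2 (volume : Measure ℝ) := by
  refine MemLp.of_le_mul (c := ‖u‖ ^ (2 * μ)) (Lp.memLp (toL2 u))
    ((continuous_powC (p := 2 * μ) (by positivity)).comp_aestronglyMeasurable
      (Lp.aestronglyMeasurable _)) ?_
  filter_upwards [ae_norm_toL2_le u] with x hx
  exact norm_powC_le (by positivity) hx

theorem coeFn_nonlinearity (hμ : 0 ≤ μ) (u : EnergySpace) :
    nonlinearity μ (toL2 u) =ᵐ[volume] fun x => powC (2 * μ) (toL2 u x) := by
  rw [nonlinearity, dif_pos (memLp_powFun hμ u)]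
  exact MemLp.coeFn_toLp _

theorem norm_nonlinearity_le (hμ : 0 ≤ μ) {R : ℝ} {u : EnergySpace} (hu : ‖u‖ ≤ R) :
    ‖nonlinearity μ (toL2 u)‖ ≤ R ^ (2 * μ) * ‖toL2 u‖ := by
  refine Lp.norm_le_mul_norm_of_ae_le_mul ?_
  filter_upwards [ae_norm_toL2_le u, coeFn_nonlinearity hμ u] with x hux hNx
  rw [hNx]
  exact norm_powC_le (by positivity) (hux.trans hu)

theorem norm_nonlinearity_sub_le (hμ : 0 ≤ μ) {R : ℝ} {u v : EnergySpace} (hu : ‖u‖ ≤ R)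
    (hv : ‖v‖ ≤ R) : ‖nonlinearity μ (toL2 u) - nonlinearity μ (toL2 v)‖ ≤
      (2 * μ + 1) * R ^ (2 * μ) * ‖toL2 u - toL2 v‖ := by
  refine Lp.norm_le_mul_norm_of_ae_le_mul ?_
  filter_upwards [ae_norm_toL2_le u, coeFn_nonlinearity hμ u, ae_norm_toL2_le v,
    coeFn_nonlinearity hμ v, Lp.coeFn_sub (toL2 u) (toL2 v),
    Lp.coeFn_sub (nonlinearity μ (toL2 u)) (nonlinearity μ (toL2 v))]
    with x hux hNux hvx hNvx hsub hNsub
  rw [hsub, hNsub, Pi.sub_apply, Pi.sub_apply, hNux, hNvx]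
  exact norm_powC_sub_le (by positivity) (hux.trans hu) (hvx.trans hv)

theorem exists_energySpace_nonlinearity (hμ : 0 ≤ μ) {R : ℝ} {u : EnergySpace} (hu : ‖u‖ ≤ R) :
    ∃ w : EnergySpace, toL2 w = nonlinearity μ (toL2 u) ∧
      ‖w‖ ≤ (2 * μ + 1) * R ^ (2 * μ) * ‖u‖ := by
  have hM : Continuous fun r : ℝ => (2 * μ + 1) * r ^ (2 * μ) :=
    continuous_const.mul (continuous_id.rpow_const fun _ => Or.inr (by positivity))
  obtain ⟨k, hk, hk_le⟩ := (hasPiecewiseDeriv_toL2 u).comp_locallyLipschitz hM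
    (Φ := powC (2 * μ)) fun r z w hz hw => norm_powC_sub_le (by positivity) hz hw
  have hk_le' : ∀ᵐ x, ‖k x‖ ≤ (2 * μ + 1) * R ^ (2 * μ) * ‖energyDeriv u x‖ := by
    filter_upwards [hk_le, ae_norm_toL2_le u] with x hkx hux
    have hux' := hux.trans hu
    exact hkx.trans (by gcongr)
  obtain ⟨w, hw, hw', -, -⟩ := hk.exists_energySpace (memLp_powFun hμ u)
    ((Lp.memLp (energyDeriv u)).of_le_mul hk.locallyIntegrable.aestronglyMeasurable hk_le')
  have heq : toL2 w = nonlinearity μ (toL2 u) := Lp.ext (hw.trans (coeFn_nonlinearity hμ u).symm)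
  have hpow : 0 ≤ R ^ (2 * μ) := Real.rpow_nonneg ((norm_nonneg u).trans hu) _
  refine ⟨w, heq, norm_le_mul_norm_of_le (by positivity) ?_
    (Lp.norm_le_mul_norm_of_ae_le_mul ?_)⟩
  · rw [heq]
    refine (norm_nonlinearity_le hμ hu).trans ?_
    gcongr
    exact le_mul_of_one_le_left hpow (by linarith)
  · filter_upwards [hk_le', hw'] with x hkx hwx
    rwa [hwx]

end PowerNonlinearity

/-! ### The nonlinear Schrödinger equation -/

section NonlinearSchrodinger

variable {γ μ : ℝ}

/-- The Cauchy problem for the nonlinear Schrödinger equation with Hamiltonian `H_γ`, in the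
energy space; the factor `i λ` is part of its nonlinearity. -/
def nlsFlow (hγ : γ ≠ 0) (lam : ℝ) (hμ : 0 ≤ μ) : SemilinearFlow L2R EnergySpace where
  generator := hamiltonian γ
  U := propagator γ
  isUnitaryGroupOf := isUnitaryGroupOf_propagator hγ
  embed := toL2
  embed_injective := toL2_injective
  UV := energyPropagator γ
  embed_UV := toL2_energyPropagator hγ
  continuous_UV := continuous_energyPropagator hγ
  bound := √(2 * ‖formOperator γ (formShift γ)‖)
  norm_UV_le := norm_energyPropagator_le hγ
  N := fun f => (Complex.I * lam) • nonlinearity μ f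
  exists_mapsTo := fun R =>
    ⟨‖Complex.I * (lam : ℂ)‖ * ((2 * μ + 1) * R ^ (2 * μ) * R), by
      rintro _ ⟨u, hu, rfl⟩
      rw [mem_closedBall_zero_iff] at hu
      have hpow : 0 ≤ R ^ (2 * μ) := Real.rpow_nonneg ((norm_nonneg u).trans hu) _
      obtain ⟨w, hw, hw_le⟩ := exists_energySpace_nonlinearity hμ hu
      refine ⟨(Complex.I * lam) • w, ?_, by rw [map_smul, hw]⟩
      rw [mem_closedBall_zero_iff, norm_smul]
      gcongr
      exact hw_le.trans (by gcongr)⟩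
  exists_lipschitz := fun R =>
    ⟨(‖Complex.I * (lam : ℂ)‖ * ((2 * μ + 1) * R ^ (2 * μ))).toNNReal,
      LipschitzOnWith.of_dist_le' (by
        rintro _ ⟨u, hu, rfl⟩ _ ⟨v, hv, rfl⟩
        rw [mem_closedBall_zero_iff] at hu hv
        rw [dist_eq_norm, dist_eq_norm, ← smul_sub, norm_smul, mul_assoc]
        gcongr
        exact norm_nonlinearity_sub_le hμ hu hv)⟩

theorem integral_propagator_nlsFlow (hγ : γ ≠ 0) (lam : ℝ) (hμ : 0 ≤ μ) (ψ : ℝ → EnergySpace)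
    (t : ℝ) :
    ∫ s in (0 : ℝ)..t, propagator γ (t - s) ((nlsFlow hγ lam hμ).N (toL2 (ψ s))) =
      (Complex.I * (lam : ℂ)) •
        ∫ s in (0 : ℝ)..t, propagator γ (t - s) (nonlinearity μ (toL2 (ψ s))) := by
  rw [← intervalIntegral.integral_smul]
  simp only [nlsFlow, map_smul]

theorem continuousOn_propagator_nonlinearity (hγ : γ ≠ 0) (hμ : 0 ≤ μ) {ψ : ℝ → EnergySpace}
    {s : Set ℝ} (hψ : ContinuousOn ψ s) (t : ℝ) :
    ContinuousOn (fun s => propagator γ (t - s) (nonlinearity μ (toL2 (ψ s)))) s := by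
  refine (((nlsFlow hγ 1 hμ).continuousOn_U_sub_N hψ t).const_smul (-Complex.I)).congr
    fun r _ => ?_
  simp [nlsFlow, smul_smul]

theorem inner_formOperator_eq_of_mem_graph (hγ : γ ≠ 0) (u v : EnergySpace) {y : L2R}
    (h : (toL2 v, y) ∈ (hamiltonian γ).graph) :
    inner ℂ (formOperator γ 0 u) v = inner ℂ (toL2 u) y := by
  rw [hamiltonian_graph, mem_hamiltonianGraph_iff hγ 0] at h
  obtain ⟨w, hw, hinner⟩ := h
  obtain rfl := toL2_injective hw
  rw [inner_formOperator_symm, ← inner_conj_symm u, hinner, inner_conj_symm]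
  simp

theorem dense_hamiltonian_domain (hγ : γ ≠ 0) :
    Dense {v : EnergySpace | ∃ y, (toL2 v, y) ∈ (hamiltonian γ).graph} :=
  (denseRange_energyResolvent hγ).mono <| by
    rintro _ ⟨f, rfl⟩
    exact ⟨_, resolvent_mem_graph hγ f⟩

theorem isSolution_iff_isMild (hγ : γ ≠ 0) (lam : ℝ) (hμ : 0 ≤ μ) {ψ₀ : EnergySpace}
    {T : EReal} {ψ : ℝ → EnergySpace} :
    IsSolution γ lam μ ψ₀ T ψ ↔ (nlsFlow hγ lam hμ).IsMild ψ₀ T ψ where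
  mp h := ((nlsFlow hγ lam hμ).isMild_iff_duhamel h.continuousOn).2 fun t ht =>
    (h.duhamel t ht).trans (congrArg _ (integral_propagator_nlsFlow hγ lam hμ ψ t).symm)
  mpr h :=
    { continuousOn := h.continuousOn
      contDiffOn := h.contDiffOn (fun u v _ => inner_formOperator_eq_of_mem_graph hγ u v)
        (dense_hamiltonian_domain hγ)
      memLp := fun t _ => memLp_powFun hμ (ψ t)
      integrable := fun t ht => intervalIntegrable_of_continuousOn_timeInterval
        (continuousOn_propagator_nonlinearity hγ hμ h.continuousOn t) ht
      duhamel := fun t ht =>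
        (((nlsFlow hγ lam hμ).isMild_iff_duhamel h.continuousOn).1 h t ht).trans
          (congrArg _ (integral_propagator_nlsFlow hγ lam hμ ψ t)) }

end NonlinearSchrodinger

end DeltaPrimeNLS

end

theorem proposition3p3_general (γ lam μ : ℝ) (hγ : γ ≠ 0) (hμ : 0 ≤ μ) :
    DeltaPrimeNLS.IsUnitaryGroupOf (DeltaPrimeNLS.hamiltonian γ) (DeltaPrimeNLS.propagator γ) ∧
    ∀ ψ₀ : DeltaPrimeNLS.EnergySpace,
      (∃ T : ℝ, 0 < T ∧ ∃ ψ : ℝ → DeltaPrimeNLS.EnergySpace,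
        DeltaPrimeNLS.IsSolution γ lam μ ψ₀ T ψ ∧
        ∀ φ : ℝ → DeltaPrimeNLS.EnergySpace, DeltaPrimeNLS.IsSolution γ lam μ ψ₀ T φ →
          Set.EqOn φ ψ (DeltaPrimeNLS.timeInterval T)) ∧
      ∃ Tstar : EReal, 0 < Tstar ∧ ∃ ψmax : ℝ → DeltaPrimeNLS.EnergySpace,
        DeltaPrimeNLS.IsSolution γ lam μ ψ₀ Tstar ψmax ∧
        (∀ (T : EReal) (φ : ℝ → DeltaPrimeNLS.EnergySpace),
          DeltaPrimeNLS.IsSolution γ lam μ ψ₀ T φ →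
            T ≤ Tstar ∧ Set.EqOn φ ψmax (DeltaPrimeNLS.timeInterval T)) ∧
        (Tstar = ⊤ ∨ ∃ b : ℝ, Tstar = b ∧
          Filter.Tendsto (fun t => ‖ψmax t‖) (nhdsWithin b (Set.Iio b)) Filter.atTop) := by
  refine ⟨DeltaPrimeNLS.isUnitaryGroupOf_propagator hγ, fun ψ₀ => ?_⟩
  simp only [DeltaPrimeNLS.isSolution_iff_isMild hγ lam hμ]
  let D := DeltaPrimeNLS.nlsFlow hγ lam hμ
  constructor
  · obtain ⟨τ, hτ, hex⟩ := D.exists_isMild ‖ψ₀‖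
    obtain ⟨ψ, hψ⟩ := hex ψ₀ le_rfl
    exact ⟨τ, hτ, ψ, hψ, fun φ hφ => hφ.eqOn hψ⟩
  · obtain ⟨ψ, hψ⟩ := D.exists_isMild_maximalTime ψ₀
    have hpos := D.maximalTime_pos ψ₀
    refine ⟨D.maximalTime ψ₀, hpos, ψ, hψ, fun T φ hφ => ⟨hφ.le_maximalTime, fun t ht =>
      hφ.apply_eq hψ ht (DeltaPrimeNLS.timeInterval_mono hφ.le_maximalTime ht)⟩, ?_⟩
    refine or_iff_not_imp_left.2 fun htop => ?_
    obtain ⟨b, hb⟩ : ∃ b : ℝ, D.maximalTime ψ₀ = b :=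
      ⟨_, (EReal.coe_toReal htop hpos.ne_bot).symm⟩
    exact ⟨b, hb, (hb ▸ hψ).tendsto_norm_atTop hb⟩

theorem proposition3p3 (γ lam μ : ℝ) (hγ : 0 < γ) (hlam : 0 < lam) (hμ : 0 < μ) :
    -- the propagator is the unitary group generated by the Hamiltonian
    DeltaPrimeNLS.IsUnitaryGroupOf (DeltaPrimeNLS.hamiltonian γ) (DeltaPrimeNLS.propagator γ) ∧
    ∀ ψ₀ : DeltaPrimeNLS.EnergySpace,
      -- local existence and uniqueness
      (∃ T : ℝ, 0 < T ∧ ∃ ψ : ℝ → DeltaPrimeNLS.EnergySpace,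
        DeltaPrimeNLS.IsSolution γ lam μ ψ₀ T ψ ∧
        ∀ φ : ℝ → DeltaPrimeNLS.EnergySpace, DeltaPrimeNLS.IsSolution γ lam μ ψ₀ T φ →
          Set.EqOn φ ψ (DeltaPrimeNLS.timeInterval T)) ∧
      -- the maximal solution, which extends every solution, and the blow-up alternative
      ∃ Tstar : EReal, 0 < Tstar ∧ ∃ ψmax : ℝ → DeltaPrimeNLS.EnergySpace,
        DeltaPrimeNLS.IsSolution γ lam μ ψ₀ Tstar ψmax ∧
        (∀ (T : EReal) (φ : ℝ → DeltaPrimeNLS.EnergySpace),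
          DeltaPrimeNLS.IsSolution γ lam μ ψ₀ T φ →
            T ≤ Tstar ∧ Set.EqOn φ ψmax (DeltaPrimeNLS.timeInterval T)) ∧
        (Tstar = ⊤ ∨ ∃ b : ℝ, Tstar = b ∧
          Filter.Tendsto (fun t => ‖ψmax t‖) (nhdsWithin b (Set.Iio b)) Filter.atTop) :=
  proposition3p3_general γ lam μ hγ.ne' hμ.le
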